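/- Let $\Omega=\Omega(\hat{\mathbb C}\setminus\{(0),1,\infty\})$ be the Riemann surface whose points are the homotopy classes of admissible curves. Here a continuous curve $\gamma:[0,1]\to\mathbb C$ with $\gamma(0)=0$ is admissible if it is constant or satisfies $\gamma(t)\in\mathbb C\setminus\{0,1\}=\hat{\mathbb C}\setminus\{0,1,\infty\}$ for all $0<t\le 1$, and homotopies run through admissible curves with a fixed endpoint. The surface $\Omega$ carries the quotient of the topology of uniform convergence of curves, and its charts are the restrictions of the endpoint projection $p:\Omega\to\mathbb C$, $p([\gamma])=\gamma(1)$, to open sets on which $p$ is a homeomorphism onto an open subset of $\mathbb C$. Write $0_\Omega$ for the class of the constant curve, and let $$\mathbb K(\omega)=\int_0^{\pi/2}\frac{d\theta}{\sqrt{1-\omega\sin^2\theta}},\qquad \omega\in\mathbb C\setminus[1,\infty),$$ with the principal branch of the square root. Then there is a biholomorphic map $\psi:\Omega\to\mathbb D$ onto the open unit disc with $\psi(0_\Omega)=0$, given by the elliptic nome $$\psi(\omega)=q(\omega)=\exp\left(-\pi\,\frac{\mathbb K(1-\omega)}{\mathbb K(\omega)}\right)$$ in the following sense. 1. For $\omega\in\mathbb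 C\setminus\big((-\infty,0]\cup[1,\infty)\big)$ we have $\mathbb K(\omega)\neq 0$, and the formula holds with the principal branches at the class of the segment $t\mapsto t\omega$. 2. Let $\gamma$ be any admissible curve, and let $t_0\in[0,1]$ be such that $|\gamma(t)|<1$ for $t\le t_0$ and $\gamma(t_0)\notin(-\infty,0]$. Then the principal germs of $\omega\mapsto\mathbb K(\omega)$ and $\omega\mapsto\mathbb K(1-\omega)$ at $\gamma(t_0)$ can be continued analytically along $\gamma|_{[t_0,1]}$. Their final values $k,k'$ at $\gamma(1)$ satisfy $k\ne0$ and $\psi([\gamma])=e^{-\pi k'/k}$. The inverse nome $\varphi=p\circ\psi^{-1}:\mathbb D\to\mathbb C$ is given on all of $\mathbb D$ by a convergent power series $$\varphi(z)=16z-128z^2+704z^3+\cdots .$$ -/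

import Mathlib

open Set Filter Topology
open scoped Manifold ContDiff

noncomputable section

namespace NomeSurface

/-- An admissible curve: it starts at `0` and is either constant or, after leaving `0`
immediately, stays in `ℂ ∖ {0, 1} = Ĉ ∖ {0, 1, ∞}`. -/
def IsCurve (γ : C(unitInterval, ℂ)) : Prop :=
  γ 0 = 0 ∧ ((∀ t, γ t = 0) ∨ ∀ t, t ≠ 0 → γ t ≠ 0 ∧ γ t ≠ 1)

/-- The space of admissible curves, with the topology of uniform convergence. -/
abbrev Curve : Type := {γ : C(unitInterval, ℂ) // IsCurve γ}

/-- Homotopy of admissible curves, through admissible curves with the same endpoint. -/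
instance curveSetoid : Setoid Curve where
  r γ η := ContinuousMap.HomotopicWith γ.1 η.1 (fun f => IsCurve f ∧ f 1 = γ.1 1)
  iseqv := by
    have key : ∀ γ η : Curve,
        ContinuousMap.HomotopicWith γ.1 η.1 (fun f => IsCurve f ∧ f 1 = γ.1 1) →
        η.1 1 = γ.1 1 := by
      rintro γ η ⟨H⟩
      have := (H.prop 1).2
      simpa using this
    refine ⟨fun γ => .refl _ ⟨γ.2, rfl⟩, fun {γ η} h => ?_, fun {γ η ζ} h₁ h₂ => ?_⟩
    · have := h.symm
      rwa [← key _ _ h] at this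
    · rw [key _ _ h₁] at h₂
      exact h₁.trans h₂

/-- The surface `Ω(Ĉ ∖ {(0), 1, ∞})`: homotopy classes of admissible curves, with the
quotient topology. -/
def Surface : Type := Quotient curveSetoid

instance : TopologicalSpace Surface := inferInstanceAs (TopologicalSpace (Quotient curveSetoid))

/-- The homotopy class of an admissible curve. -/
def Surface.mk (γ : Curve) : Surface := Quotient.mk curveSetoid γ

theorem end_eq {γ η : Curve} (h : γ ≈ η) : η.1 1 = γ.1 1 := by
  obtain ⟨H⟩ := h
  simpa using (H.prop 1).2

/-- The projection to the plane: the common endpoint of the curves of a class. -/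
def Surface.proj : Surface → ℂ :=
  Quotient.lift (fun γ : Curve => γ.1 1) fun _ _ h => (end_eq h).symm

/-- The straight curve `t ↦ t w` as a continuous map. -/
def segMap (w : ℂ) : C(unitInterval, ℂ) := ⟨fun t => (t : ℝ) * w, by fun_prop⟩

theorem segMap_isCurve {w : ℂ} (h : w ∉ Complex.ofReal '' Ici (1 : ℝ)) : IsCurve (segMap w) := by
  refine ⟨by simp [segMap], ?_⟩
  by_cases h0 : w = 0
  · left; intro t; simp [segMap, h0]
  · right
    intro t ht
    have ht0 : (t : ℝ) ≠ 0 := fun h => ht (Subtype.ext h)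
    have htp : 0 < (t : ℝ) := lt_of_le_of_ne t.2.1 (Ne.symm ht0)
    refine ⟨by simp [segMap, h0, ht0], fun h1 => h ⟨(t : ℝ)⁻¹, ?_, ?_⟩⟩
    · exact (one_le_inv₀ htp).2 t.2.2
    · have : ((t : ℝ) : ℂ) * w = 1 := h1
      push_cast
      exact (eq_inv_of_mul_eq_one_right this).symm

theorem logLift (η η₀ : C(unitInterval, ℂ)) (h : ∀ t, t ≠ 0 → η t ≠ 0)
    (h₀ : ∀ t, t ≠ 0 → η₀ t ≠ 0) (he : η 1 = η₀ 1) :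
    ∃ D : unitInterval → ℂ, ContinuousOn D {0}ᶜ ∧ D 1 = 0 ∧
      ∀ t, t ≠ 0 → η t = η₀ t * Complex.exp (D t) := by
  set P : ℝ → unitInterval := projIcc 0 1 zero_le_one with hP
  have hPc : Continuous P := continuous_projIcc
  have hP0 : ∀ t : ℝ, 0 < t → P t ≠ 0 := by
    intro t ht h
    have : ((P t : unitInterval) : ℝ) = 0 := by rw [h]; rfl
    rw [hP, coe_projIcc] at this
    have h2 : 0 < min 1 t := lt_min one_pos ht
    have h3 := le_max_right 0 (min 1 t)
    linarith
  have hsc : IsSimplyConnected (Ioi (0 : ℝ)) :=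
    by
    have := Convex.contractibleSpace (convex_Ioi (0 : ℝ)) ⟨1, by simp⟩
    exact SimplyConnectedSpace.ofContractible _
  obtain ⟨f, hf, hfe⟩ := Complex.exists_continuousOn_eqOn_exp_comp hsc isOpen_Ioi
    (g := fun t => η (P t) / η₀ (P t))
    (ContinuousOn.div (by fun_prop) (by fun_prop) fun t ht => h₀ _ (hP0 t ht))
    (by
      rintro ⟨t, ht, h1⟩
      exact div_ne_zero (h _ (hP0 t ht)) (h₀ _ (hP0 t ht)) h1)
  have hPt : ∀ t : unitInterval, P t = t := fun t => projIcc_val zero_le_one t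
  have hpos : ∀ t : unitInterval, t ≠ 0 → (0 : ℝ) < t := fun t ht =>
    lt_of_le_of_ne t.2.1 fun h => ht (Subtype.ext h.symm)
  have hexp : ∀ t : unitInterval, t ≠ 0 → Complex.exp (f t) = η t / η₀ t := by
    intro t ht
    have := hfe (hpos t ht)
    simpa [hPt] using this
  have hexp1 : Complex.exp (f 1) = 1 := by
    have := hexp 1 (by simp)
    rw [he, div_self (h₀ 1 (by simp))] at this
    simpa using this
  refine ⟨fun t => f t - f 1, ?_, by simp, fun t ht => ?_⟩
  · refine ContinuousOn.sub (hf.comp (by fun_prop) fun t ht => hpos t ht) continuousOn_const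
  · rw [Complex.exp_sub, hexp t ht, hexp1, div_one, mul_div_cancel₀ _ (h₀ t ht)]

theorem homotopic_of_log {η η₀ : Curve} (h₀ : ∀ t, t ≠ 0 → η₀.1 t ≠ 0)
    {D : unitInterval → ℂ} (hD : ContinuousOn D {0}ᶜ) (hD1 : D 1 = 0)
    (hη : ∀ t, t ≠ 0 → η.1 t = η₀.1 t * Complex.exp (D t))
    (hav : ∀ t, t ≠ 0 → (‖η₀.1 t‖ < 1 ∧ ‖η.1 t‖ < 1) ∨
      ∀ s : unitInterval, η₀.1 t * Complex.exp ((s : ℝ) * D t) ≠ 1) : η₀ ≈ η := by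
  classical
  set F : unitInterval × unitInterval → ℂ := fun x =>
    if x.2 = 0 then 0 else η₀.1 x.2 * Complex.exp ((x.1 : ℝ) * D x.2) with hF
  have hbound : ∀ x, ‖F x‖ ≤ max ‖η₀.1 x.2‖ ‖η.1 x.2‖ := by
    intro ⟨s, t⟩
    by_cases ht : t = 0
    · simp [hF, ht]
    · simp only [hF, ht, if_false, hη t ht, norm_mul, Complex.norm_exp]
      have h1 : (((s : ℝ) : ℂ) * D t).re = s * (D t).re := by simp
      rw [h1]
      rcases le_total 0 (D t).re with h | h
      · refine le_max_of_le_right ?_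
        gcongr
        exact mul_le_of_le_one_left h s.2.2
      · refine le_max_of_le_left ?_
        refine mul_le_of_le_one_right (norm_nonneg _) ?_
        exact Real.exp_le_one_iff.2 (mul_nonpos_of_nonneg_of_nonpos s.2.1 h)
  have hFc : Continuous F := by
    rw [continuous_iff_continuousAt]
    rintro ⟨s, t⟩
    by_cases ht : t = 0
    · subst ht
      have hz : F (s, 0) = 0 := by simp [hF]
      rw [ContinuousAt, hz]
      refine squeeze_zero_norm hbound ?_
      have hc : Continuous fun x : unitInterval × unitInterval =>
          max ‖η₀.1 x.2‖ ‖η.1 x.2‖ := by fun_prop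
      have := hc.tendsto (s, 0)
      simpa [η₀.2.1, η.2.1] using this
    · have hev : F =ᶠ[𝓝 (s, t)] fun x => η₀.1 x.2 * Complex.exp ((x.1 : ℝ) * D x.2) := by
        have : ∀ᶠ x : unitInterval × unitInterval in 𝓝 (s, t), x.2 ≠ 0 :=
          continuousAt_snd.eventually_ne ht
        filter_upwards [this] with x hx
        simp [hF, hx]
      refine ContinuousAt.congr ?_ hev.symm
      have hDt : ContinuousAt (fun x : unitInterval × unitInterval => D x.2) (s, t) :=
        ContinuousAt.comp (f := Prod.snd) (x := (s, t))
          (hD.continuousAt (isOpen_compl_singleton.mem_nhds ht)) continuousAt_snd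
      have hs : ContinuousAt (fun x : unitInterval × unitInterval => ((x.1 : ℝ) : ℂ)) (s, t) :=
        Continuous.continuousAt (by fun_prop)
      have hη₀ : ContinuousAt (fun x : unitInterval × unitInterval => η₀.1 x.2) (s, t) :=
        Continuous.continuousAt (by fun_prop)
      exact hη₀.mul (hs.mul hDt).cexp
  refine ⟨⟨⟨⟨F, hFc⟩, fun t => ?_, fun t => ?_⟩, fun s => ⟨⟨?_, Or.inr fun t ht => ?_⟩, ?_⟩⟩⟩
  · by_cases ht : t = 0
    · simp [hF, ht, η₀.2.1]
    · simp [hF, ht]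
  · by_cases ht : t = 0
    · simp [hF, ht, η.2.1]
    · simp [hF, ht, hη t ht]
  · simp [hF]
  · constructor
    · simp [hF, ht, h₀ t ht]
    · rcases hav t ht with h | h
      · intro h1
        have h2 := hbound (s, t)
        have h3 : F (s, t) = 1 := h1
        rw [h3, norm_one] at h2
        exact absurd h2 (not_le.2 (max_lt h.1 h.2))
      · have := h s
        simpa [hF, ht] using this
  · simp [hF, hD1]


theorem Curve.ne_of_end {γ : Curve} (h : γ.1 1 ≠ 0) (t : unitInterval) (ht : t ≠ 0) :
    γ.1 t ≠ 0 ∧ γ.1 t ≠ 1 := by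
  rcases γ.2.2 with h' | h'
  · exact absurd (h' 1) h
  · exact h' t ht

theorem isCurve_smul {γ : Curve} (h : γ.1 1 ≠ 0) {c : ℂ} (hc : c ≠ 0) (hr : c⁻¹ ∉ range γ.1) :
    IsCurve (c • γ.1) := by
  refine ⟨by simp [γ.2.1], Or.inr fun t ht => ⟨?_, fun h1 => hr ⟨t, ?_⟩⟩⟩
  · simpa using ⟨hc, (γ.ne_of_end h t ht).1⟩
  · exact eq_inv_of_mul_eq_one_right h1

theorem Curve.one_notMem (γ : Curve) : (1 : ℂ) ∉ range γ.1 := by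
  rintro ⟨t, ht⟩
  by_cases h0 : t = 0
  · rw [h0, γ.2.1] at ht; exact zero_ne_one ht
  · rcases γ.2.2 with h | h
    · rw [h t] at ht; exact zero_ne_one ht
    · exact (h t h0).2 ht

theorem eventually_inv_notMem {X : Type*} [TopologicalSpace X] [CompactSpace X] (f : C(X, ℂ))
    (h : (1 : ℂ) ∉ range f) : ∀ᶠ c in 𝓝 (1 : ℂ), c ≠ 0 ∧ c⁻¹ ∉ range f := by
  have h1 : Tendsto (fun c : ℂ => c⁻¹) (𝓝 1) (𝓝 1) := by
    simpa using tendsto_inv₀ (one_ne_zero (α := ℂ))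
  have h2 : (range f)ᶜ ∈ 𝓝 (1 : ℂ) := (isCompact_range f.continuous).isClosed.isOpen_compl.mem_nhds h
  exact (eventually_ne_nhds one_ne_zero).and (h1 h2)

theorem homotopic_smul {η₀ η₁ : Curve} (hη : η₀.1 1 ≠ 0) (h : η₀ ≈ η₁) :
    ∀ᶠ c in 𝓝 (1 : ℂ), ∀ (h₀ : IsCurve (c • η₀.1)) (h₁ : IsCurve (c • η₁.1)),
      (⟨_, h₀⟩ : Curve) ≈ ⟨_, h₁⟩ := by
  obtain ⟨H⟩ := h
  have hcur : ∀ s, IsCurve (H.toHomotopy.curry s) := fun s => (H.prop s).1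
  have hend : ∀ s, H.toHomotopy.curry s 1 = η₀.1 1 := fun s => (H.prop s).2
  have h1 : (1 : ℂ) ∉ range H.toContinuousMap := by
    rintro ⟨⟨s, t⟩, hst⟩
    exact Curve.one_notMem ⟨_, hcur s⟩ ⟨t, hst⟩
  filter_upwards [eventually_inv_notMem _ h1] with c hc h₀ h₁
  refine ⟨⟨⟨c • H.toContinuousMap, fun t => ?_, fun t => ?_⟩, fun s => ⟨?_, ?_⟩⟩⟩
  · exact congrArg (c * ·) (H.apply_zero t)
  · exact congrArg (c * ·) (H.apply_one t)
  · exact isCurve_smul (γ := ⟨_, hcur s⟩) (by simpa only [hend s] using hη) hc.1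
      fun ⟨t, ht⟩ => hc.2 ⟨(s, t), ht⟩
  · exact congrArg (c * ·) (hend s)

theorem eventually_homotopic {η₀ : Curve} (h0 : η₀.1 1 ≠ 0) :
    ∀ᶠ η : Curve in 𝓝 η₀, ∃ h : IsCurve ((η.1 1 / η₀.1 1) • η₀.1), (⟨_, h⟩ : Curve) ≈ η := by
  have hev : Continuous fun x : Curve × unitInterval => x.1.1 x.2 := by fun_prop
  have hev1 : Continuous fun x : Curve => x.1 1 := by fun_prop
  -- the scaling factor tends to `1`
  have hc : Tendsto (fun η : Curve => η.1 1 / η₀.1 1) (𝓝 η₀) (𝓝 1) := by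
    have := (hev1.tendsto η₀).div_const (η₀.1 1)
    rwa [div_self h0] at this
  -- an initial piece of the interval on which everything is small
  obtain ⟨ε, hε0, hε⟩ : ∃ ε : unitInterval, 0 < ε ∧ ∀ t, t ≤ ε → ‖η₀.1 t‖ < 1 / 2 := by
    have h1 : ∀ᶠ t in 𝓝 (0 : unitInterval), ‖η₀.1 t‖ < 1 / 2 := by
      have : Tendsto (fun t => ‖η₀.1 t‖) (𝓝 0) (𝓝 ‖η₀.1 0‖) :=
        (η₀.1.continuous.norm).tendsto 0
      rw [η₀.2.1, norm_zero] at this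
      exact this.eventually (gt_mem_nhds (by norm_num))
    obtain ⟨u, hu, hu'⟩ := exists_Ico_subset_of_mem_nhds h1 ⟨1, zero_lt_one⟩
    obtain ⟨ε, h2, h3⟩ := exists_between hu
    exact ⟨ε, h2, fun t ht => hu' ⟨t.2.1, ht.trans_lt h3⟩⟩
  have hsmall : ∀ᶠ η : Curve in 𝓝 η₀, ∀ t ∈ Iic ε,
      ‖(η.1 1 / η₀.1 1) • η₀.1 t‖ < 1 ∧ ‖η.1 t‖ < 1 := by
    refine isClosed_Iic.isCompact.eventually_forall_of_forall_eventually fun t ht => ?_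
    have c1 : Continuous fun x : Curve × unitInterval =>
        ‖(x.1.1 1 / η₀.1 1) • η₀.1 x.2‖ := by fun_prop
    have c2 : Continuous fun x : Curve × unitInterval => ‖x.1.1 x.2‖ := by fun_prop
    have := hε t ht
    refine ((c1.tendsto (η₀, t)).eventually (gt_mem_nhds ?_)).and
      ((c2.tendsto (η₀, t)).eventually (gt_mem_nhds ?_))
    · rw [div_self h0, one_smul]; linarith
    · linarith
  -- the remaining piece
  have hK : IsCompact (Ici ε ×ˢ (univ : Set unitInterval)) := isClosed_Ici.isCompact.prod isCompact_univ
  have hlarge : ∀ᶠ η : Curve in 𝓝 η₀, ∀ x ∈ Ici ε ×ˢ (univ : Set unitInterval),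
      η.1 x.1 / ((η.1 1 / η₀.1 1) • η₀.1 x.1) ∈ Complex.slitPlane ∧
      ((η.1 1 / η₀.1 1) • η₀.1 x.1) * Complex.exp ((x.2 : ℝ) *
        Complex.log (η.1 x.1 / ((η.1 1 / η₀.1 1) • η₀.1 x.1))) ≠ 1 := by
    refine hK.eventually_forall_of_forall_eventually fun ⟨t, s⟩ hts => ?_
    have ht : t ≠ 0 := fun h => absurd (h ▸ hts.1 : ε ≤ 0) (not_le.2 hε0)
    have hne := η₀.ne_of_end h0 t ht
    have c1 : Continuous fun x : Curve × (unitInterval × unitInterval) =>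
        (x.1.1 1 / η₀.1 1) • η₀.1 x.2.1 := by fun_prop
    have c2 : Continuous fun x : Curve × (unitInterval × unitInterval) => x.1.1 x.2.1 := by
      fun_prop
    have c3 : Continuous fun x : Curve × (unitInterval × unitInterval) =>
        ((x.2.2 : ℝ) : ℂ) := by fun_prop
    have hv : (η₀.1 1 / η₀.1 1) • η₀.1 t = η₀.1 t := by rw [div_self h0, one_smul]
    have cq : ContinuousAt (fun x : Curve × (unitInterval × unitInterval) =>
        x.1.1 x.2.1 / ((x.1.1 1 / η₀.1 1) • η₀.1 x.2.1)) (η₀, (t, s)) :=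
      c2.continuousAt.div c1.continuousAt (by simpa only [hv] using hne.1)
    have hq : η₀.1 t / ((η₀.1 1 / η₀.1 1) • η₀.1 t) = 1 := by rw [hv, div_self hne.1]
    have hsl : η₀.1 t / ((η₀.1 1 / η₀.1 1) • η₀.1 t) ∈ Complex.slitPlane := by
      rw [hq]; exact Complex.one_mem_slitPlane
    refine (cq.eventually (Complex.isOpen_slitPlane.mem_nhds hsl)).and ?_
    refine (c1.continuousAt.mul (c3.continuousAt.mul (cq.clog hsl)).cexp).eventually_ne ?_
    change (η₀.1 1 / η₀.1 1) • η₀.1 t * Complex.exp ((s : ℝ) *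
      Complex.log (η₀.1 t / ((η₀.1 1 / η₀.1 1) • η₀.1 t))) ≠ 1
    rw [hq, hv, Complex.log_one, mul_zero, Complex.exp_zero, mul_one]
    exact hne.2
  filter_upwards [hsmall, hlarge, hc.eventually (eventually_inv_notMem _ η₀.one_notMem),
    hev1.continuousAt.eventually_ne h0] with η hs hl hη hη1
  refine ⟨isCurve_smul h0 hη.1 hη.2, ?_⟩
  set ζ : Curve := ⟨_, isCurve_smul h0 hη.1 hη.2⟩ with hζ
  have hζ1 : ζ.1 1 = η.1 1 := div_mul_cancel₀ _ h0
  have hζ0 : ζ.1 1 ≠ 0 := by rwa [hζ1]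
  obtain ⟨D, hD, hD1, hDe⟩ := logLift η.1 ζ.1 (fun t ht => (η.ne_of_end hη1 t ht).1)
    (fun t ht => (ζ.ne_of_end hζ0 t ht).1) hζ1.symm
  have hI0 : ∀ t ∈ Ici ε, t ≠ 0 := fun t ht h => absurd (h ▸ ht : ε ≤ 0) (not_le.2 hε0)
  have hlog : EqOn D (fun t => Complex.log (η.1 t / ζ.1 t)) (Ici ε) := by
    refine Complex.isCoveringMap_exp.eqOn_of_comp_eqOn isPreconnected_Ici
      (hD.mono fun t ht => hI0 t ht) ?_ ?_ (a := 1) unitInterval.le_one' ?_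
    · refine ContinuousOn.clog (ContinuousOn.div (by fun_prop) (by fun_prop)
        fun t ht => (ζ.ne_of_end hζ0 t (hI0 t ht)).1) fun t ht => ?_
      exact (hl (t, 0) ⟨ht, mem_univ _⟩).1
    · intro t ht
      have hz := (ζ.ne_of_end hζ0 t (hI0 t ht)).1
      have hn := (η.ne_of_end hη1 t (hI0 t ht)).1
      refine Subtype.ext ?_
      simp only [Function.comp]
      rw [Complex.exp_log (div_ne_zero hn hz), hDe t (hI0 t ht), mul_div_cancel_left₀ _ hz]
    · rw [hD1, hζ1, div_self hη1, Complex.log_one]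
  refine homotopic_of_log (fun t ht => (ζ.ne_of_end hζ0 t ht).1) hD hD1 hDe fun t ht => ?_
  rcases le_total t ε with h | h
  · exact Or.inl (hs t h)
  · right
    intro s
    rw [hlog h]
    exact (hl (t, s) ⟨h, mem_univ _⟩).2

theorem homotopic_of_norm_lt {η η₀ : Curve} (h₀ : ∀ t, ‖η₀.1 t‖ < 1) (h : ∀ t, ‖η.1 t‖ < 1)
    (he : η.1 1 = η₀.1 1) : η₀ ≈ η := by
  by_cases h0 : η₀.1 1 = 0
  · have hz : ∀ γ : Curve, γ.1 1 = 0 → ∀ t, γ.1 t = 0 := fun γ hγ =>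
      γ.2.2.resolve_right fun h' => (h' 1 (by simp)).1 hγ
    have : η₀ = η := Subtype.ext <| ContinuousMap.ext fun t => by
      rw [hz η₀ h0, hz η (he.trans h0)]
    rw [this]
  · have h1 : η.1 1 ≠ 0 := he ▸ h0
    obtain ⟨D, hD, hD1, hDe⟩ := logLift η.1 η₀.1 (fun t ht => (η.ne_of_end h1 t ht).1)
      (fun t ht => (η₀.ne_of_end h0 t ht).1) he
    exact homotopic_of_log (fun t ht => (η₀.ne_of_end h0 t ht).1) hD hD1 hDe
      fun t _ => Or.inl ⟨h₀ t, h t⟩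

theorem Surface.continuous_mk : Continuous Surface.mk := continuous_quotient_mk'

theorem Surface.continuous_proj : Continuous Surface.proj :=
  Continuous.quotient_lift (by fun_prop) _

/-- A chart of the surface from a continuous family of curves with prescribed endpoints. -/
theorem exists_chart {V : Set ℂ} (hV : IsOpen V) (c : V → Curve) (hc : Continuous c)
    (he : ∀ v, (c v).1 1 = v)
    (ho : ∀ (v : V) (η : Curve), c v ≈ η →
      ∀ᶠ η' : Curve in 𝓝 η, ∃ h : η'.1 1 ∈ V, c ⟨_, h⟩ ≈ η') (v : V) :
    ∃ e : OpenPartialHomeomorph Surface ℂ, Surface.mk (c v) ∈ e.source ∧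
      Surface.proj = e := by
  classical
  let g : ℂ → Surface := fun z => if h : z ∈ V then Surface.mk (c ⟨z, h⟩) else Surface.mk (c v)
  have hg : ∀ (z : ℂ) (h : z ∈ V), g z = Surface.mk (c ⟨z, h⟩) := fun z h => dif_pos h
  have hpg : ∀ z ∈ V, Surface.proj (g z) = z := fun z h => by
    rw [hg z h]; exact he ⟨z, h⟩
  refine ⟨{ toFun := Surface.proj, invFun := g, source := g '' V, target := V
            map_source' := ?_, map_target' := fun z h => mem_image_of_mem g h
            left_inv' := ?_, right_inv' := hpg
            open_source := ?_, open_target := hV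
            continuousOn_toFun := Surface.continuous_proj.continuousOn
            continuousOn_invFun := ?_ }, ⟨v, v.2, hg v v.2⟩, rfl⟩
  · rintro _ ⟨z, h, rfl⟩; rw [hpg z h]; exact h
  · rintro _ ⟨z, h, rfl⟩; rw [hpg z h]
  · rw [continuousOn_iff_continuous_domRestrict]
    have : V.domRestrict g = Surface.mk ∘ c := funext fun z => hg z z.2
    rw [this]
    exact Surface.continuous_mk.comp hc
  · change IsOpen (Quotient.mk curveSetoid ⁻¹' (g '' V))
    rw [isOpen_iff_mem_nhds]
    rintro η ⟨z, h, hz⟩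
    rw [hg z h] at hz
    filter_upwards [ho ⟨z, h⟩ η (Quotient.exact hz)] with η' hη'
    obtain ⟨h', hh⟩ := hη'
    exact ⟨_, h', (hg _ h').trans (Quotient.sound hh)⟩

theorem eventually_of_smul {γ η : Curve} (hγ : γ.1 1 ≠ 0) (h : γ ≈ η) :
    ∀ᶠ η' : Curve in 𝓝 η, ∃ h : IsCurve ((η'.1 1 / γ.1 1) • γ.1), (⟨_, h⟩ : Curve) ≈ η' := by
  have he := end_eq h
  have hη : η.1 1 ≠ 0 := he ▸ hγ
  have hc : Tendsto (fun η' : Curve => η'.1 1 / γ.1 1) (𝓝 η) (𝓝 1) := by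
    have hev1 : Continuous fun x : Curve => x.1 1 := by fun_prop
    have := (hev1.tendsto η).div_const (γ.1 1)
    rwa [he, div_self hγ] at this
  filter_upwards [eventually_homotopic hη, hc.eventually (homotopic_smul hγ h),
    hc.eventually (eventually_inv_notMem _ γ.one_notMem)] with η' h1 h2 h3
  have h4 := isCurve_smul hγ h3.1 h3.2
  obtain ⟨h5, h6⟩ := h1
  refine ⟨h4, Setoid.trans (h2 h4 (by rwa [he] at h5)) ?_⟩
  simpa only [he] using h6

theorem notMem_of_norm_lt {v : ℂ} (h : ‖v‖ < 1) : v ∉ Complex.ofReal '' Ici (1 : ℝ) := by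
  rintro ⟨x, hx, rfl⟩
  rw [Complex.norm_real, Real.norm_eq_abs] at h
  exact absurd (hx.trans (le_abs_self x)) (not_le.2 h)

/-- The endpoint projection is a local homeomorphism. -/
theorem Surface.isLocalHomeomorph_proj : IsLocalHomeomorph Surface.proj := by
  rintro ⟨γ⟩
  by_cases h0 : γ.1 1 = 0
  · have hz : ∀ t, γ.1 t = 0 := γ.2.2.resolve_right fun h' => (h' 1 (by simp)).1 h0
    let c : Metric.ball (0 : ℂ) 1 → Curve := fun v =>
      ⟨segMap v, segMap_isCurve (notMem_of_norm_lt (mem_ball_zero_iff.1 v.2))⟩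
    have hc : Continuous c := by
      refine Continuous.subtype_mk ?_ _
      refine ContinuousMap.continuous_of_continuous_uncurry _ ?_
      change Continuous fun x : Metric.ball (0 : ℂ) 1 × unitInterval => ((x.2 : ℝ) : ℂ) * x.1
      fun_prop
    have hce : ∀ v, (c v).1 1 = v := fun v => by simp [c, segMap]
    have hcn : ∀ v t, ‖(c v).1 t‖ < 1 := fun v t => by
      have h1 : ‖(v : ℂ)‖ < 1 := mem_ball_zero_iff.1 v.2
      have h2 : ‖(c v).1 t‖ = (t : ℝ) * ‖(v : ℂ)‖ := by
        simp [c, segMap, abs_of_nonneg t.2.1]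
      rw [h2]
      exact (mul_le_of_le_one_left (norm_nonneg _) t.2.2).trans_lt h1
    have hγ : γ = c ⟨0, by simp⟩ := Subtype.ext <| ContinuousMap.ext fun t => by
      rw [hz t]; simp [c, segMap]
    have := exists_chart Metric.isOpen_ball c hc hce ?_ ⟨0, by simp⟩
    · rwa [← hγ] at this
    · intro v η hη
      by_cases hv : (v : ℂ) = 0
      · have hη0 : η.1 1 = 0 := by rw [end_eq hη, hce, hv]
        have hηz : ∀ t, η.1 t = 0 := η.2.2.resolve_right fun h' => (h' 1 (by simp)).1 hη0
        have : ∀ᶠ η' : Curve in 𝓝 η, ∀ t ∈ (univ : Set unitInterval), ‖η'.1 t‖ < 1 := by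
          refine isCompact_univ.eventually_forall_of_forall_eventually fun t _ => ?_
          have c2 : Continuous fun x : Curve × unitInterval => ‖x.1.1 x.2‖ := by fun_prop
          refine (c2.tendsto (η, t)).eventually (gt_mem_nhds ?_)
          simp [hηz]
        filter_upwards [this] with η' h'
        have hm : η'.1 1 ∈ Metric.ball (0 : ℂ) 1 := by simpa using h' 1 (mem_univ _)
        exact ⟨hm, homotopic_of_norm_lt (hcn _) (fun t => h' t (mem_univ _)) (hce ⟨_, hm⟩).symm⟩
      · have hv1 : (c v).1 1 ≠ 0 := by rwa [hce]
        have hev1 : Continuous fun x : Curve => x.1 1 := by fun_prop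
        have hm : ∀ᶠ η' : Curve in 𝓝 η, η'.1 1 ∈ Metric.ball (0 : ℂ) 1 := by
          refine hev1.continuousAt.eventually (Metric.isOpen_ball.mem_nhds ?_)
          change η.1 1 ∈ _
          rw [end_eq hη, hce]; exact v.2
        filter_upwards [eventually_of_smul hv1 hη, hm] with η' h1 h2
        obtain ⟨h3, h4⟩ := h1
        refine ⟨h2, ?_⟩
        have : c ⟨_, h2⟩ = ⟨_, h3⟩ := Subtype.ext <| ContinuousMap.ext fun t => by
          change ((t : ℝ) : ℂ) * η'.1 1 = (η'.1 1 / (c v).1 1) * ((t : ℝ) * v)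
          rw [hce]
          field_simp
        rwa [this]
  · let V : Set ℂ := {v | v ≠ 0 ∧ γ.1 1 / v ∉ range γ.1}
    have hV : IsOpen V := by
      rw [isOpen_iff_mem_nhds]
      rintro v ⟨hv, hv'⟩
      have h1 : ContinuousAt (fun v => γ.1 1 / v) v := continuousAt_const.div continuousAt_id hv
      exact (eventually_ne_nhds hv).and
        (h1 ((isCompact_range γ.1.continuous).isClosed.isOpen_compl.mem_nhds hv'))
    have hcur : ∀ v ∈ V, IsCurve ((v / γ.1 1) • γ.1) := fun v hv =>
      isCurve_smul h0 (div_ne_zero hv.1 h0) (by rw [inv_div]; exact hv.2)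
    let c : V → Curve := fun v => ⟨_, hcur v v.2⟩
    have hc : Continuous c := by
      refine Continuous.subtype_mk ?_ _
      fun_prop
    have hce : ∀ v, (c v).1 1 = v := fun v => div_mul_cancel₀ _ h0
    have hmem : γ.1 1 ∈ V := ⟨h0, by rw [div_self h0]; exact γ.one_notMem⟩
    have hγ : γ = c ⟨_, hmem⟩ := Subtype.ext <| by
      change γ.1 = (γ.1 1 / γ.1 1) • γ.1
      rw [div_self h0, one_smul]
    have := exists_chart hV c hc hce ?_ ⟨_, hmem⟩
    · rwa [← hγ] at this
    · intro v η hη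
      have hv1 : (c v).1 1 ≠ 0 := by rw [hce]; exact v.2.1
      have hev1 : Continuous fun x : Curve => x.1 1 := by fun_prop
      have hm : ∀ᶠ η' : Curve in 𝓝 η, η'.1 1 ∈ V := by
        refine hev1.continuousAt.eventually (hV.mem_nhds ?_)
        change η.1 1 ∈ _
        rw [end_eq hη, hce]; exact v.2
      filter_upwards [eventually_of_smul hv1 hη, hm] with η' h1 h2
      obtain ⟨h3, h4⟩ := h1
      refine ⟨h2, ?_⟩
      have : c ⟨_, h2⟩ = ⟨_, h3⟩ := Subtype.ext <| ContinuousMap.ext fun t => by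
        have := v.2.1
        change (η'.1 1 / γ.1 1) * γ.1 t =
          (η'.1 1 / (c v).1 1) * ((v / γ.1 1) * γ.1 t)
        rw [hce]
        field_simp
      rwa [this]

/-- The charts are the local inverses of the endpoint projection. -/
instance : ChartedSpace ℂ Surface where
  atlas := {e | Surface.proj = e}
  chartAt x := (Surface.isLocalHomeomorph_proj x).choose
  mem_chart_source x := (Surface.isLocalHomeomorph_proj x).choose_spec.1
  chart_mem_atlas x := (Surface.isLocalHomeomorph_proj x).choose_spec.2

/-- The transition maps are restrictions of the identity, so the surface is a Riemann surface. -/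
instance : IsManifold 𝓘(ℂ, ℂ) ω Surface := by
  refine isManifold_of_contDiffOn _ _ _ fun e e' he he' => ?_
  refine contDiffOn_id.congr fun z hz => ?_
  simp only [mfld_simps] at hz ⊢
  have h1 : (e : Surface → ℂ) = e' := Eq.trans (Eq.symm he) he'
  rw [← h1]
  exact e.right_inv hz.1

/-- The distinguished point over `0`: the class of the constant curve. -/
def Surface.origin : Surface := Surface.mk ⟨segMap 0, segMap_isCurve (by simp)⟩

/-- The points of the first sheet, reached by a straight segment from `0`. -/
def Surface.seg (w : ℂ) (h : w ∉ Complex.ofReal '' Ici (1 : ℝ)) : Surface :=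
  Surface.mk ⟨segMap w, segMap_isCurve h⟩

/-- The complete elliptic integral of the first kind as a function of the parameter
`m = k²`, in its principal branch on `ℂ ∖ [1, ∞)`. -/
def ellipticK (m : ℂ) : ℂ :=
  ∫ θ in (0 : ℝ)..(Real.pi / 2), (1 - m * (Real.sin θ : ℂ) ^ 2) ^ (-(1 / 2) : ℂ)

/-- `F t` is a germ at `γ t` for `t₀ ≤ t ≤ 1`, and `F` is the analytic continuation of the
germ of `f` at `γ t₀` along `γ`. -/
structure IsContinuation (γ : C(unitInterval, ℂ)) (t₀ : unitInterval) (f : ℂ → ℂ)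
    (F : unitInterval → ℂ → ℂ) : Prop where
  start : F t₀ =ᶠ[𝓝 (γ t₀)] f
  analytic : ∀ t, t₀ ≤ t → AnalyticAt ℂ (F t) (γ t)
  compat : ∀ t, t₀ ≤ t → ∀ᶠ s in 𝓝[Ici t₀] t, F s =ᶠ[𝓝 (γ s)] F t

/-- The open unit disc. -/
def disc : TopologicalSpace.Opens ℂ := ⟨Metric.ball 0 1, Metric.isOpen_ball⟩

end NomeSurface

end

open NomeSurface

/-! With q = e^{iπτ}, the theta constants θ₃ = ∑ q^{n²} (`nomeB`) and q^{-1/4} θ₂ = ∑ q^{n(n+1)}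
(`nomeA`) are holomorphic in the disc, and φ(q) = q A⁴/B⁴ is the modular function λ written in the
nome. The doubling identities `nomeB_sq` and `nomeA_sq` give Jacobi's identity. They link z with
±z², so a zero of A, of B or of φ' would reproduce itself along a sequence tending to 0, where none
of the three vanishes. Hence φ is a local homeomorphism of the disc that vanishes only at 0 and
omits 1.

The map λ is a covering of ℂ ∖ {0, 1} (`isCoveringMapOn_lam`): SL(2, ℤ) acts on its values through
the anharmonic group, so sections can be found over the fundamental domain, and the part of that
domain below a given height is compact. An admissible curve therefore lifts through φ
(`exists_lift`): near 0 by the local inverse of φ, afterwards by the covering λ. Sending z to the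
class of the φ-image of the ray from 0 to z maps the disc onto Ω, because every lift can be
straightened to a ray (`toSurface_lift`). The map is injective by monodromy (`lift_end_eq`).
Followed by the endpoint projection it is φ, so it is biholomorphic; ψ is its inverse.

For the formula, Landen's transformation shows that K(φ(x))/B(x)² does not change under x ↦ x² for
real x in (0, 1); letting x tend to 0 gives the value π/2. The identity theorem extends K = (π/2)
θ₃² to the doubly slit plane, with τ a section of λ (`ellipticK_eq_thetaSq`). The inversion τ ↦ -1/τ
gives K(1 - w) = -iτ K(w), so e^{-πK'/K} = e^{iπτ}. On the other sheets both integrals are continued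
as analytic functions of the lifted τ. The Maclaurin coefficients come from truncating the theta
series. -/

noncomputable section

namespace NomeSurface

section

/-! ### Sparse power series indexed by the integers -/

/-- The lacunary series `∑ z ^ e n` over the integers. -/
def sparseSeries (e : ℤ → ℕ) (z : ℂ) : ℂ := ∑' n : ℤ, z ^ e n

theorem summable_pow_natAbs {r : ℝ} (h0 : 0 ≤ r) (h1 : r < 1) :
    Summable fun n : ℤ => r ^ n.natAbs := by
  refine Summable.of_nat_of_neg ?_ ?_ <;> simpa using summable_geometric_of_lt_one h0 h1

/-- Comparison with r⁻¹ ∑ r^|n|. The summand 1 in the hypothesis is needed for n(n + 1) at n = -1,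
and it costs the factor r⁻¹, so r = 0 is treated apart. -/
theorem summable_norm_sparse {e : ℤ → ℕ} (he : ∀ n, n.natAbs ≤ e n + 1) {r : ℝ} (h0 : 0 ≤ r)
    (h1 : r < 1) : Summable fun n : ℤ => r ^ e n := by
  rcases h0.eq_or_lt with rfl | hr
  · refine summable_of_hasFiniteSupport ((Set.finite_Icc (-1 : ℤ) 1).subset fun n hn => ?_)
    have h2 : e n = 0 := by
      by_contra h
      exact hn (zero_pow h)
    have := he n
    constructor <;> omega
  · refine Summable.of_nonneg_of_le (fun n => by positivity) (fun n => ?_)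
      ((summable_pow_natAbs h0 h1).mul_left r⁻¹)
    have := pow_le_pow_of_le_one h0 h1.le (he n)
    rw [pow_succ] at this
    rw [inv_mul_eq_div, le_div_iff₀ hr]
    exact this

theorem summable_norm_sparse_complex {e : ℤ → ℕ} (he : ∀ n, n.natAbs ≤ e n + 1) {z : ℂ}
    (hz : ‖z‖ < 1) : Summable fun n : ℤ => ‖z ^ e n‖ := by
  simpa only [norm_pow] using summable_norm_sparse he (norm_nonneg z) hz

theorem differentiableOn_sparseSeries {e : ℤ → ℕ} (he : ∀ n, n.natAbs ≤ e n + 1) :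
    DifferentiableOn ℂ (sparseSeries e) (Metric.ball 0 1) := by
  intro z hz
  have hz1 : ‖z‖ < 1 := by simpa using hz
  obtain ⟨r, hr1, hr2⟩ := exists_between hz1
  have hr0 : 0 ≤ r := (norm_nonneg z).trans hr1.le
  have : DifferentiableOn ℂ (sparseSeries e) (Metric.ball 0 r) := by
    refine Complex.differentiableOn_tsum_of_summable_norm (summable_norm_sparse he hr0 hr2)
      (fun n => (differentiable_id.pow _).differentiableOn) Metric.isOpen_ball fun n w hw => ?_
    have : ‖w‖ < r := by simpa using hw
    rw [norm_pow]
    gcongr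
  exact ((this z (by simpa using hr1)).differentiableAt
    (Metric.isOpen_ball.mem_nhds (by simpa using hr1))).differentiableWithinAt

/-- The exponents `n²`. -/
def sqExp (n : ℤ) : ℕ := n.natAbs ^ 2

/-- The exponents `n (n + 1)`. -/
def prExp (n : ℤ) : ℕ := (n * (n + 1)).toNat

theorem cast_sqExp (n : ℤ) : (sqExp n : ℤ) = n ^ 2 := by simp [sqExp]

theorem cast_prExp (n : ℤ) : (prExp n : ℤ) = n * (n + 1) := by
  refine Int.toNat_of_nonneg ?_
  rcases le_or_gt 0 n with h | h
  · positivity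
  · nlinarith

theorem natAbs_le_sqExp (n : ℤ) : n.natAbs ≤ sqExp n + 1 := by
  have := cast_sqExp n
  zify
  rw [this]
  rcases abs_cases n with h | h <;> nlinarith

theorem natAbs_le_prExp (n : ℤ) : n.natAbs ≤ prExp n + 1 := by
  have := cast_prExp n
  zify
  rw [this]
  rcases abs_cases n with h | h
  · nlinarith
  · rcases eq_or_ne n (-1) with rfl | h'
    · simp
    · have : n ≤ -2 := by omega
      nlinarith

/-- `θ₃` as a function of the nome. -/
def nomeB (z : ℂ) : ℂ := sparseSeries sqExp z

/-- `q^(-1/4) θ₂` as a function of the nome `q`. -/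
def nomeA (z : ℂ) : ℂ := sparseSeries prExp z

/-- Splitting pairs of integers according to the parity of their sum. -/
def parityEquiv : (ℤ × ℤ) ⊕ (ℤ × ℤ) ≃ ℤ × ℤ where
  toFun := Sum.elim (fun p => (p.1 + p.2, p.1 - p.2)) fun p => (p.1 + p.2 + 1, p.1 - p.2)
  invFun p := if (p.1 + p.2) % 2 = 0 then Sum.inl ((p.1 + p.2) / 2, (p.1 - p.2) / 2)
    else Sum.inr ((p.1 + p.2 - 1) / 2, (p.1 - p.2 - 1) / 2)
  left_inv := by
    rintro (⟨a, b⟩ | ⟨a, b⟩)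
    · have h : (a + b + (a - b)) % 2 = 0 := by omega
      simp only [Sum.elim_inl, h, if_true]
      congr 2 <;> omega
    · have h : ¬ (a + b + 1 + (a - b)) % 2 = 0 := by omega
      simp only [Sum.elim_inr, h, if_false]
      congr 2 <;> omega
  right_inv := by
    rintro ⟨m, n⟩
    by_cases h : (m + n) % 2 = 0
    · simp only [h, if_true, Sum.elim_inl]
      ext <;> dsimp only <;> omega
    · simp only [h, if_false, Sum.elim_inr]
      ext <;> dsimp only <;> omega

/-! ### Doubling identities for the theta constants -/

theorem _root_.HasSum.of_forall_eq {ι : Type*} {f g : ι → ℂ} {a : ℂ} (hg : HasSum g a)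
    (h : ∀ i, f i = g i) : HasSum f a :=
  (funext h : f = g) ▸ hg

theorem sparse_mul {e f : ℤ → ℕ} (he : ∀ n, n.natAbs ≤ e n + 1) (hf : ∀ n, n.natAbs ≤ f n + 1)
    {z : ℂ} (hz : ‖z‖ < 1) :
    HasSum (fun p : ℤ × ℤ => z ^ (e p.1 + f p.2)) (sparseSeries e z * sparseSeries f z) := by
  have h1 := summable_norm_sparse_complex he hz
  have h2 := summable_norm_sparse_complex hf hz
  have h3 : Summable fun p : ℤ × ℤ => z ^ e p.1 * z ^ f p.2 :=
    summable_mul_of_summable_norm (f := fun n => z ^ e n) (g := fun n => z ^ f n) h1 h2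
  have h4 : sparseSeries e z * sparseSeries f z = ∑' p : ℤ × ℤ, z ^ e p.1 * z ^ f p.2 :=
    tsum_mul_tsum_of_summable_norm (f := fun n => z ^ e n) (g := fun n => z ^ f n) h1 h2
  rw [h4]
  simp only [pow_add]
  exact h3.hasSum

theorem norm_sq_lt_one {z : ℂ} (hz : ‖z‖ < 1) : ‖z ^ 2‖ < 1 := by
  rw [norm_pow]
  exact pow_lt_one₀ (norm_nonneg z) hz two_ne_zero

/-- Pairs of equal parity are (a + b, a - b), with square sum 2(a² + b²). The others are (a + b + 1,
a - b), with square sum 2(a(a + 1) + b(b + 1)) + 1; the last 1 is the factor z. -/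
theorem nomeB_sq {z : ℂ} (hz : ‖z‖ < 1) :
    nomeB z ^ 2 = nomeB (z ^ 2) ^ 2 + z * nomeA (z ^ 2) ^ 2 := by
  have h := sparse_mul natAbs_le_sqExp natAbs_le_sqExp hz
  have hB := sparse_mul natAbs_le_sqExp natAbs_le_sqExp (norm_sq_lt_one hz)
  have hA := (sparse_mul natAbs_le_prExp natAbs_le_prExp (norm_sq_lt_one hz)).mul_left z
  rw [← parityEquiv.hasSum_iff] at h
  rw [nomeB, nomeB, nomeA, pow_two, pow_two (sparseSeries sqExp _),
    pow_two (sparseSeries prExp _)]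
  refine h.unique (HasSum.sum ?_ ?_)
  · refine hB.of_forall_eq ?_
    rintro ⟨a, b⟩
    simp only [Function.comp_apply, parityEquiv, Equiv.coe_fn_mk, Sum.elim_inl, ← pow_mul]
    congr 1
    zify
    simp only [cast_sqExp]
    ring
  · refine hA.of_forall_eq ?_
    rintro ⟨a, b⟩
    simp only [Function.comp_apply, parityEquiv, Equiv.coe_fn_mk, Sum.elim_inr, ← pow_mul,
      ← pow_succ']
    congr 1
    zify
    simp only [cast_sqExp, cast_prExp]
    ring

theorem nomeA_sq {z : ℂ} (hz : ‖z‖ < 1) :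
    nomeA z ^ 2 = 2 * nomeA (z ^ 2) * nomeB (z ^ 2) := by
  have h := sparse_mul natAbs_le_prExp natAbs_le_prExp hz
  have h1 := sparse_mul natAbs_le_prExp natAbs_le_sqExp (norm_sq_lt_one hz)
  have h2 := sparse_mul natAbs_le_sqExp natAbs_le_prExp (norm_sq_lt_one hz)
  rw [← parityEquiv.hasSum_iff] at h
  -- On the odd class the exponent is 2((a + 1)² + b(b + 1)), so the first index of the second
  -- product is shifted by one.
  rw [← ((Equiv.addRight (1 : ℤ)).prodCongr (Equiv.refl ℤ)).hasSum_iff] at h2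
  have : (2 : ℂ) * nomeA (z ^ 2) * nomeB (z ^ 2) =
      nomeA (z ^ 2) * nomeB (z ^ 2) + nomeB (z ^ 2) * nomeA (z ^ 2) := by ring
  rw [this, nomeB, nomeA, nomeA, pow_two]
  refine h.unique (HasSum.sum ?_ ?_)
  · refine h1.of_forall_eq ?_
    rintro ⟨a, b⟩
    simp only [Function.comp_apply, parityEquiv, Equiv.coe_fn_mk, Sum.elim_inl, ← pow_mul]
    congr 1
    zify
    simp only [cast_sqExp, cast_prExp]
    ring
  · refine h2.of_forall_eq ?_
    rintro ⟨a, b⟩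
    simp only [Function.comp_apply, parityEquiv, Equiv.coe_fn_mk, Sum.elim_inr, ← pow_mul,
      Equiv.prodCongr_apply, Prod.map, Equiv.coe_addRight, Equiv.refl_apply]
    congr 1
    zify
    simp only [cast_sqExp, cast_prExp]
    ring

theorem nomeA_neg (z : ℂ) : nomeA (-z) = nomeA z := by
  refine tsum_congr fun n => Even.neg_pow ?_ z
  have := Int.even_mul_succ_self n
  rw [← cast_prExp n] at this
  exact_mod_cast this

/-- Jacobi's identity between the fourth powers of the theta constants. -/
theorem nomeB_pow_four {z : ℂ} (hz : ‖z‖ < 1) :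
    nomeB z ^ 4 - nomeB (-z) ^ 4 = z * nomeA z ^ 4 := by
  have h1 := nomeB_sq hz
  have h2 := nomeB_sq (z := -z) (by simpa using hz)
  have h3 := nomeA_sq hz
  rw [neg_sq] at h2
  -- The squares at z and -z are X + zY and X - zY with the same X and Y, so the difference of their
  -- squares is 4zXY.
  calc nomeB z ^ 4 - nomeB (-z) ^ 4 = (nomeB z ^ 2) ^ 2 - (nomeB (-z) ^ 2) ^ 2 := by ring
    _ = z * (2 * nomeA (z ^ 2) * nomeB (z ^ 2)) ^ 2 := by rw [h1, h2]; ring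
    _ = z * nomeA z ^ 4 := by rw [← h3]; ring

/-! ### Zero-freeness of the theta constants -/

theorem differentiableOn_nomeA : DifferentiableOn ℂ nomeA (Metric.ball 0 1) :=
  differentiableOn_sparseSeries natAbs_le_prExp

theorem differentiableOn_nomeB : DifferentiableOn ℂ nomeB (Metric.ball 0 1) :=
  differentiableOn_sparseSeries natAbs_le_sqExp

theorem differentiableAt_nomeA {z : ℂ} (hz : ‖z‖ < 1) : DifferentiableAt ℂ nomeA z :=
  differentiableOn_nomeA.differentiableAt (Metric.isOpen_ball.mem_nhds (by simpa using hz))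

theorem differentiableAt_nomeB {z : ℂ} (hz : ‖z‖ < 1) : DifferentiableAt ℂ nomeB z :=
  differentiableOn_nomeB.differentiableAt (Metric.isOpen_ball.mem_nhds (by simpa using hz))

theorem nomeB_zero : nomeB 0 = 1 := by
  rw [nomeB, sparseSeries, tsum_eq_single 0]
  · simp [sqExp]
  · intro n hn
    exact zero_pow (by simpa [sqExp] using hn)

theorem nomeA_zero : nomeA 0 = 2 := by
  -- The exponent n(n + 1) vanishes at exactly two integers, hence the value 2.
  have : ∀ n ∉ ({0, -1} : Finset ℤ), (0 : ℂ) ^ prExp n = 0 := by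
    intro n hn
    refine zero_pow fun h => hn ?_
    have h1 := cast_prExp n
    rw [h, Nat.cast_zero, eq_comm, mul_eq_zero] at h1
    simp only [Finset.mem_insert, Finset.mem_singleton]
    omega
  rw [nomeA, sparseSeries, tsum_eq_sum this]
  simp [prExp]
  norm_num

/-- A function whose zeros propagate under a squaring map has no zeros in the disc. -/
theorem ne_zero_of_propagate {g σ : ℂ → ℂ} (hσ : ∀ z, ‖σ z‖ = ‖z‖ ^ 2) (hg : ContinuousAt g 0)
    (h0 : g 0 ≠ 0) (h : ∀ z, ‖z‖ < 1 → g z = 0 → g (σ z) = 0) {z : ℂ} (hz : ‖z‖ < 1) :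
    g z ≠ 0 := by
  intro hgz
  have hn : ∀ n : ℕ, ‖σ^[n] z‖ = ‖z‖ ^ 2 ^ n := by
    intro n
    induction n with
    | zero => simp
    | succ n ih => rw [Function.iterate_succ_apply', hσ, ih, ← pow_mul, pow_succ]
  have hlt : ∀ n : ℕ, ‖σ^[n] z‖ < 1 := fun n => by
    rw [hn]; exact pow_lt_one₀ (norm_nonneg z) hz (by positivity)
  have hzero : ∀ n : ℕ, g (σ^[n] z) = 0 := by
    intro n
    induction n with
    | zero => simpa
    | succ n ih => rw [Function.iterate_succ_apply']; exact h _ (hlt n) ih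
  -- The orbit of a zero consists of zeros and tends to 0, which contradicts continuity and g 0 ≠ 0.
  have ht : Tendsto (fun n : ℕ => σ^[n] z) atTop (𝓝 0) := by
    rw [tendsto_zero_iff_norm_tendsto_zero]
    simp only [hn]
    exact (tendsto_pow_atTop_nhds_zero_of_lt_one (norm_nonneg z) hz).comp
      (tendsto_pow_atTop_atTop_of_one_lt one_lt_two)
  have := hg.tendsto.comp ht
  simp only [Function.comp_def, hzero] at this
  exact h0 (tendsto_nhds_unique this tendsto_const_nhds)

/-- If B(z) = 0, doubling gives B(z²)² = -z A(z²)², hence B(z²)⁴ = z² A(z²)⁴. Jacobi's identity at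
z² then forces B(-z²) = 0, so zeros propagate under z ↦ -z². -/
theorem nomeB_ne_zero {z : ℂ} (hz : ‖z‖ < 1) : nomeB z ≠ 0 := by
  refine ne_zero_of_propagate (σ := fun z => -z ^ 2) (by simp)
    (differentiableAt_nomeB (by simp)).continuousAt (by simp [nomeB_zero]) (fun z hz h => ?_) hz
  have h1 := nomeB_sq hz
  have h2 := nomeB_pow_four (norm_sq_lt_one hz)
  rw [h] at h1
  have h3 : nomeB (-z ^ 2) ^ 4 = 0 := by linear_combination (nomeB (z ^ 2) ^ 2 -
    z * nomeA (z ^ 2) ^ 2) * (-h1) - h2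
  exact pow_eq_zero_iff (by norm_num) |>.1 h3

theorem nomeA_ne_zero {z : ℂ} (hz : ‖z‖ < 1) : nomeA z ≠ 0 := by
  refine ne_zero_of_propagate (σ := fun z => z ^ 2) (by simp)
    (differentiableAt_nomeA (by simp)).continuousAt (by simp [nomeA_zero]) (fun z hz h => ?_) hz
  have h1 := nomeA_sq hz
  rw [h] at h1
  simpa [nomeB_ne_zero (norm_sq_lt_one hz)] using h1

/-- The inverse nome: the modular function `λ` as a function of the nome. -/
def phi (z : ℂ) : ℂ := z * nomeA z ^ 4 / nomeB z ^ 4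

theorem one_sub_phi {z : ℂ} (hz : ‖z‖ < 1) : 1 - phi z = nomeB (-z) ^ 4 / nomeB z ^ 4 := by
  have h := nomeB_ne_zero hz
  rw [phi, ← nomeB_pow_four hz]
  field_simp
  ring

theorem phi_ne_one {z : ℂ} (hz : ‖z‖ < 1) : phi z ≠ 1 := by
  intro h
  have h1 := one_sub_phi hz
  rw [h, sub_self, eq_comm, div_eq_zero_iff] at h1
  have h2 := nomeB_ne_zero (z := -z) (by simpa using hz)
  rcases h1 with h1 | h1
  · exact pow_ne_zero 4 h2 h1
  · exact pow_ne_zero 4 (nomeB_ne_zero hz) h1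

@[simp] theorem phi_zero : phi 0 = 0 := by simp [phi]

theorem phi_ne_zero {z : ℂ} (hz : ‖z‖ < 1) (h0 : z ≠ 0) : phi z ≠ 0 :=
  div_ne_zero (mul_ne_zero h0 (pow_ne_zero _ (nomeA_ne_zero hz))) (pow_ne_zero _ (nomeB_ne_zero hz))

/-- A is even, and z ↦ -z exchanges B(z) with B(-z). In terms of τ this is the translation τ ↦ τ +
1. -/
theorem phi_neg {z : ℂ} (hz : ‖z‖ < 1) : phi (-z) = phi z / (phi z - 1) := by
  have h1 := one_sub_phi hz
  have h2 := nomeB_ne_zero hz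
  have h3 := nomeB_ne_zero (z := -z) (by simpa using hz)
  have : phi z - 1 = -(nomeB (-z) ^ 4 / nomeB z ^ 4) := by rw [← h1]; ring
  rw [this, phi, phi, nomeA_neg]
  field_simp

/-! ### Analyticity of the inverse nome, the Landen modulus and non-vanishing of the derivative -/

theorem differentiableAt_phi {z : ℂ} (hz : ‖z‖ < 1) : DifferentiableAt ℂ phi z :=
  (differentiableAt_id.mul ((differentiableAt_nomeA hz).pow 4)).div
    ((differentiableAt_nomeB hz).pow 4) (pow_ne_zero _ (nomeB_ne_zero hz))

theorem analyticOnNhd_phi : AnalyticOnNhd ℂ phi (Metric.ball 0 1) :=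
  DifferentiableOn.analyticOnNhd
    (fun z hz => (differentiableAt_phi (by simpa using hz)).differentiableWithinAt)
    Metric.isOpen_ball

/-- The modulus belonging to the squared nome. -/
def modulus (z : ℂ) : ℂ := z * nomeA (z ^ 2) ^ 2 / nomeB (z ^ 2) ^ 2

theorem modulus_sq (z : ℂ) : modulus z ^ 2 = phi (z ^ 2) := by
  rw [modulus, phi]; ring

theorem nomeB_sq_eq_modulus {z : ℂ} (hz : ‖z‖ < 1) :
    nomeB z ^ 2 = (1 + modulus z) * nomeB (z ^ 2) ^ 2 := by
  have h := nomeB_ne_zero (norm_sq_lt_one hz)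
  rw [nomeB_sq hz, modulus]
  field_simp

theorem modulus_ne {z : ℂ} (hz : ‖z‖ < 1) : 1 + modulus z ≠ 0 ∧ 1 - modulus z ≠ 0 := by
  rw [← mul_ne_zero_iff]
  have : (1 + modulus z) * (1 - modulus z) = 1 - phi (z ^ 2) := by rw [← modulus_sq]; ring
  rw [this]
  exact sub_ne_zero.2 (phi_ne_one (norm_sq_lt_one hz)).symm

/-- Landen's transformation of the modular function. -/
theorem phi_eq_modulus {z : ℂ} (hz : ‖z‖ < 1) :
    phi z = 4 * modulus z / (1 + modulus z) ^ 2 := by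
  have h1 := (modulus_ne hz).1
  have h2 := nomeB_ne_zero (norm_sq_lt_one hz)
  have h3 : nomeB z ^ 4 = ((1 + modulus z) * nomeB (z ^ 2) ^ 2) ^ 2 := by
    rw [← nomeB_sq_eq_modulus hz]; ring
  have h4 : nomeA z ^ 4 = (2 * nomeA (z ^ 2) * nomeB (z ^ 2)) ^ 2 := by
    rw [← nomeA_sq hz]; ring
  have h5 : modulus z * nomeB (z ^ 2) ^ 2 = z * nomeA (z ^ 2) ^ 2 := by
    rw [modulus]; field_simp
  rw [phi, h3, h4]
  rw [div_eq_div_iff (by positivity) (by positivity)]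
  linear_combination (-4) * nomeB (z ^ 2) ^ 2 * (1 + modulus z) ^ 2 * h5

theorem hasDerivAt_phi_zero : HasDerivAt phi 16 0 := by
  have hA := (differentiableAt_nomeA (z := 0) (by simp)).hasDerivAt
  have hB := (differentiableAt_nomeB (z := 0) (by simp)).hasDerivAt
  refine (((hasDerivAt_id (0 : ℂ)).mul (hA.pow 4)).div (hB.pow 4)
    (pow_ne_zero _ (nomeB_ne_zero (by simp)))).congr_deriv ?_
  simp [nomeA_zero, nomeB_zero]
  norm_num

theorem differentiableAt_modulus {z : ℂ} (hz : ‖z‖ < 1) : DifferentiableAt ℂ modulus z := by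
  have hA : DifferentiableAt ℂ (fun z => nomeA (z ^ 2)) z :=
    (differentiableAt_nomeA (norm_sq_lt_one hz)).comp z (differentiableAt_id.pow 2)
  have hB : DifferentiableAt ℂ (fun z => nomeB (z ^ 2)) z :=
    (differentiableAt_nomeB (norm_sq_lt_one hz)).comp z (differentiableAt_id.pow 2)
  exact (differentiableAt_id.mul (hA.pow 2)).div (hB.pow 2)
    (pow_ne_zero _ (nomeB_ne_zero (norm_sq_lt_one hz)))

/-- Differentiating φ = 4k/(1 + k)² gives φ' = 4k'(1 - k)/(1 + k)³, so a critical point of φ is one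
of k. Differentiating k² = φ(z²) then gives 2z φ'(z²) = 0. Critical points thus propagate under z ↦
z², while φ'(0) = 16. -/
theorem deriv_phi_ne_zero {z : ℂ} (hz : ‖z‖ < 1) : deriv phi z ≠ 0 := by
  refine ne_zero_of_propagate (σ := fun z => z ^ 2) (by simp)
    ((analyticOnNhd_phi 0 (by simp)).deriv.continuousAt) (by simp [hasDerivAt_phi_zero.deriv])
    (fun z hz h => ?_) hz
  rcases eq_or_ne z 0 with rfl | hz0
  · simpa using h
  have hk := (differentiableAt_modulus hz).hasDerivAt
  obtain ⟨hp, hm⟩ := modulus_ne hz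
  have h1 : HasDerivAt (fun z => 4 * modulus z / (1 + modulus z) ^ 2)
      (4 * deriv modulus z * (1 - modulus z) / (1 + modulus z) ^ 3) z := by
    refine ((hk.const_mul 4).div ((hk.const_add 1).pow 2) (pow_ne_zero 2 hp)).congr_deriv ?_
    simp only [Pi.pow_apply]
    rw [div_eq_div_iff (pow_ne_zero _ (pow_ne_zero _ hp)) (pow_ne_zero _ hp)]
    push_cast
    ring
  have h2 : HasDerivAt phi (4 * deriv modulus z * (1 - modulus z) / (1 + modulus z) ^ 3) z := by
    refine h1.congr_of_eventuallyEq ?_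
    filter_upwards [Metric.isOpen_ball.mem_nhds (show z ∈ Metric.ball (0 : ℂ) 1 by simpa)] with w hw
    exact phi_eq_modulus (by simpa using hw)
  have h3 : deriv modulus z = 0 := by
    rw [h2.deriv] at h
    have := pow_ne_zero 3 hp
    simpa [this, hm] using h
  have h4 : HasDerivAt (fun z => phi (z ^ 2)) (deriv phi (z ^ 2) * (2 * z)) z := by
    have := (differentiableAt_phi (norm_sq_lt_one hz)).hasDerivAt.comp z (hasDerivAt_pow 2 z)
    simpa [Function.comp_def] using this
  have h5 : HasDerivAt (fun z => phi (z ^ 2)) (2 * modulus z * deriv modulus z) z := by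
    have := hk.pow 2
    simp only [← modulus_sq]
    simpa [Pi.pow_def] using this
  have h6 := h4.unique h5
  simpa [h3, hz0] using h6

end

section

/-! ### Local homeomorphisms and even coverings -/

theorem isLocalHomeomorphOn_of_deriv_ne_zero {f : ℂ → ℂ} {s : Set ℂ}
    (h : ∀ z ∈ s, AnalyticAt ℂ f z ∧ deriv f z ≠ 0) : IsLocalHomeomorphOn f s := fun z hz => by
  have h1 : HasStrictDerivAt f (deriv f z) z := (h z hz).1.hasStrictDerivAt
  exact ⟨(h1.hasStrictFDerivAt_equiv (h z hz).2).toOpenPartialHomeomorph f,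
    HasStrictFDerivAt.mem_toOpenPartialHomeomorph_source _, rfl⟩

theorem isLocalHomeomorph_comp_of_deriv_ne_zero {E : Type*} [TopologicalSpace E] {c : E → ℂ}
    (hc : IsOpenEmbedding c) {f : ℂ → ℂ} (h : ∀ e, AnalyticAt ℂ f (c e) ∧ deriv f (c e) ≠ 0) :
    IsLocalHomeomorph (f ∘ c) := by
  rw [isLocalHomeomorph_iff_isLocalHomeomorphOn_univ]
  refine (isLocalHomeomorphOn_of_deriv_ne_zero (s := range c) ?_).comp
    hc.isLocalHomeomorph.isLocalHomeomorphOn fun e _ => mem_range_self e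
  rintro _ ⟨e, rfl⟩
  exact h e

section Covering

variable {E X : Type*} [TopologicalSpace E] [TopologicalSpace X]

theorem isOpenEmbedding_section {f : E → X} (hf : IsLocalHomeomorph f) {V : Set X}
    (hV : IsOpen V) {s : X → E} (hs : ContinuousOn s V) (hfs : ∀ v ∈ V, f (s v) = v) :
    IsOpenEmbedding (V.domRestrict s) := by
  refine hf.isOpenEmbedding_of_comp ?_ (continuousOn_iff_continuous_domRestrict.1 hs)
  have : f ∘ V.domRestrict s = Subtype.val := funext fun v => hfs v v.2
  rw [this]
  exact hV.isOpenEmbedding_subtypeVal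

/-- A connected open set over which every point of the total space lies on a section is evenly
covered. -/
theorem isEvenlyCovered_of_sections [T2Space E] {f : E → X} (hf : IsLocalHomeomorph f)
    {V : Set X} (hV : IsOpen V) (hVc : IsPreconnected V) {x : X} (hx : x ∈ V)
    (h : ∀ e, f e ∈ V → ∃ s : X → E, ContinuousOn s V ∧ (∀ v ∈ V, f (s v) = v) ∧ s (f e) = e) :
    IsEvenlyCovered f x (f ⁻¹' {x}) := by
  have : DiscreteTopology (f ⁻¹' {x}) :=
    (IsDiscrete.of_openPartialHomeomorph f subset_rfl fun e _ => by
      obtain ⟨φ, h1, h2⟩ := hf e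
      exact ⟨φ, h1, h2.symm⟩).1
  -- Sections over the connected set V that agree at one point agree throughout.
  have huniq : ∀ s t : X → E, ContinuousOn s V → ContinuousOn t V → (∀ v ∈ V, f (s v) = v) →
      (∀ v ∈ V, f (t v) = v) → ∀ v ∈ V, s v = t v → EqOn s t V := by
    intro s t hs ht hfs hft v hv hst
    refine (T2Space.isSeparatedMap f).eqOn_of_comp_eqOn hf.isLocallyInjective hVc hs ht ?_ hv hst
    intro v hv
    simp [hfs v hv, hft v hv]
  rcases isEmpty_or_nonempty (f ⁻¹' {x}) with hemp | hne
  · refine .of_preimage_eq_empty _ (hV.mem_nhds hx) ?_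
    rw [eq_empty_iff_forall_notMem]
    intro e he
    obtain ⟨s, -, h2, -⟩ := h e he
    exact hemp.false ⟨s x, h2 x hx⟩
  have : Nonempty E := ⟨(Classical.arbitrary (f ⁻¹' {x})).1⟩
  choose s hsc hfs hse using fun i : f ⁻¹' {x} => h i.1 (by rw [i.2]; exact hx)
  have hsx : ∀ i, s i x = i.1 := fun i => by
    have := hse i
    rwa [show f i.1 = x from i.2] at this
  have himg : ∀ (i) {W : Set X}, W ⊆ V → f ⁻¹' W ∩ s i '' V = s i '' W := by
    intro i W hW
    ext e
    constructor
    · rintro ⟨h1, v, hv, rfl⟩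
      rw [mem_preimage, hfs i v hv] at h1
      exact ⟨v, h1, rfl⟩
    · rintro ⟨v, hv, rfl⟩
      exact ⟨by rw [mem_preimage, hfs i v (hW hv)]; exact hv, v, hW hv, rfl⟩
  -- The sheets are the images of the sections through the points of the fibre over x. Uniqueness
  -- makes them disjoint, and the section through any e over V is one of them, namely the one with
  -- the same value at x.
  refine .of_trivialization (t := hV.trivializationDiscrete (fun i => s i '' V) V
    (fun i W hW => ⟨fun hWo => ?_, fun hWo => ?_⟩) (fun i => ?_) (fun i v hv => ?_)
    (fun i j hij => ?_) fun e he => ?_) hx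
  · rw [himg i hW]
    have := (isOpenEmbedding_section hf hV (hsc i) (hfs i)).isOpenMap _
      (hWo.preimage continuous_subtype_val)
    rwa [domRestrict_eq, image_comp, Subtype.image_preimage_coe, inter_eq_right.2 hW] at this
  · rw [himg i hW] at hWo
    have := hf.isOpenMap _ hWo
    rw [image_image] at this
    rwa [image_congr (fun v hv => hfs i v (hW hv)), image_id'] at this
  · rintro _ ⟨v, hv, rfl⟩ _ ⟨w, hw, rfl⟩ h1
    rw [hfs i v hv, hfs i w hw] at h1
    rw [h1]
  · exact ⟨s i v, ⟨v, hv, rfl⟩, hfs i v hv⟩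
  · refine disjoint_left.2 ?_
    rintro _ ⟨v, hv, rfl⟩ ⟨w, hw, h1⟩
    have hvw : v = w := by rw [← hfs i v hv, ← h1, hfs j w hw]
    subst hvw
    have := huniq _ _ (hsc i) (hsc j) (hfs i) (hfs j) v hv h1.symm hx
    rw [hsx, hsx] at this
    exact hij (Subtype.ext this)
  · obtain ⟨t, h1, h2, h3⟩ := h e he
    let i : f ⁻¹' {x} := ⟨t x, h2 x hx⟩
    refine mem_iUnion.2 ⟨i, f e, he, ?_⟩
    rw [huniq _ _ (hsc i) h1 (hfs i) h2 x hx (hsx i) he, h3]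

/-- Over a compact set, a local homeomorphism has local sections on balls of uniform size. -/
theorem exists_uniform_sections {Y : Type*} [PseudoMetricSpace Y] {f : E → Y}
    (hf : IsLocalHomeomorph f) {C : Set E} (hC : IsCompact C) :
    ∃ δ > 0, ∀ e ∈ C, ∃ s : Y → E, ContinuousOn s (Metric.ball (f e) δ) ∧
      (∀ v ∈ Metric.ball (f e) δ, f (s v) = v) ∧ s (f e) = e := by
  refine hC.induction_on (p := fun S => ∃ δ > 0, ∀ e ∈ S, ∃ s : Y → E,
    ContinuousOn s (Metric.ball (f e) δ) ∧ (∀ v ∈ Metric.ball (f e) δ, f (s v) = v) ∧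
      s (f e) = e) ⟨1, one_pos, by simp⟩ ?_ ?_ ?_
  · rintro S T hST ⟨δ, h0, h⟩
    exact ⟨δ, h0, fun e he => h e (hST he)⟩
  · rintro S T ⟨δ, h0, h⟩ ⟨ε, h0', h'⟩
    refine ⟨min δ ε, lt_min h0 h0', ?_⟩
    rintro e (he | he)
    · obtain ⟨s, h1, h2, h3⟩ := h e he
      have := Metric.ball_subset_ball (x := f e) (min_le_left δ ε)
      exact ⟨s, h1.mono this, fun v hv => h2 v (this hv), h3⟩
    · obtain ⟨s, h1, h2, h3⟩ := h' e he
      have := Metric.ball_subset_ball (x := f e) (min_le_right δ ε)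
      exact ⟨s, h1.mono this, fun v hv => h2 v (this hv), h3⟩
  · intro e _
    obtain ⟨φ, he, hφ⟩ := hf e
    obtain ⟨δ, hδ, hb⟩ := Metric.isOpen_iff.1 φ.open_target (φ e) (φ.map_source he)
    have hfe : f e = φ e := by rw [hφ]
    -- Half the radius, so that for e' near e the ball about f e' still lies in the ball about f e,
    -- hence in the chart's target.
    refine ⟨φ.source ∩ f ⁻¹' Metric.ball (f e) (δ / 2), mem_nhdsWithin_of_mem_nhds
      (inter_mem (φ.open_source.mem_nhds he)
        (hf.continuous.continuousAt (Metric.ball_mem_nhds _ (half_pos hδ)))), δ / 2, half_pos hδ, ?_⟩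
    rintro e' ⟨h1, h2⟩
    have hsub : Metric.ball (f e') (δ / 2) ⊆ φ.target := by
      refine Subset.trans (fun v hv => ?_) hb
      rw [← hfe]
      have := dist_triangle v (f e') (f e)
      rw [Metric.mem_ball] at hv ⊢
      have h2' : dist (f e') (f e) < δ / 2 := h2
      linarith
    refine ⟨φ.symm, φ.continuousOn_symm.mono hsub, fun v hv => ?_, ?_⟩
    · rw [hφ]; exact φ.right_inv (hsub hv)
    · rw [hφ]; exact φ.left_inv h1

end Covering

end

section

open UpperHalfPlane (im)
open scoped UpperHalfPlane Modular MatrixGroups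

/-! ### The modular function -/

/-- The nome `e^{iπτ}`. -/
def nome (τ : ℂ) : ℂ := Complex.exp (Real.pi * Complex.I * τ)

theorem norm_nome (τ : ℂ) : ‖nome τ‖ = Real.exp (-(Real.pi * τ.im)) := by
  rw [nome, Complex.norm_exp]
  congr 1
  simp

theorem norm_nome_lt_one {τ : ℂ} (hτ : 0 < τ.im) : ‖nome τ‖ < 1 := by
  rw [norm_nome, Real.exp_lt_one_iff]
  have := mul_pos Real.pi_pos hτ
  linarith

theorem nome_ne_zero (τ : ℂ) : nome τ ≠ 0 := Complex.exp_ne_zero _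

theorem nome_pow (τ : ℂ) (n : ℕ) : nome τ ^ n = Complex.exp (Real.pi * Complex.I * n * τ) := by
  rw [nome, ← Complex.exp_nat_mul]
  congr 1
  ring

theorem nome_add_one (τ : ℂ) : nome (τ + 1) = -nome τ := by
  rw [nome, mul_add, mul_one, Complex.exp_add, Complex.exp_pi_mul_I, nome]
  ring

theorem cast_sqExp_complex (n : ℤ) : (sqExp n : ℂ) = (n : ℂ) ^ 2 := by
  have := congrArg (fun m : ℤ => (m : ℂ)) (cast_sqExp n)
  simpa using this

theorem cast_prExp_complex (n : ℤ) : (prExp n : ℂ) = n * (n + 1) := by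
  have := congrArg (fun m : ℤ => (m : ℂ)) (cast_prExp n)
  simpa using this

theorem nomeB_nome (τ : ℂ) : nomeB (nome τ) = jacobiTheta₂ 0 τ := by
  refine tsum_congr fun n => ?_
  rw [nome_pow, jacobiTheta₂_term, cast_sqExp_complex]
  congr 1
  ring

theorem nomeA_nome (τ : ℂ) : nomeA (nome τ) = jacobiTheta₂ (τ / 2) τ := by
  refine tsum_congr fun n => ?_
  rw [nome_pow, jacobiTheta₂_term, cast_prExp_complex]
  congr 1
  ring

theorem nomeB_neg_nome (τ : ℂ) : nomeB (-nome τ) = jacobiTheta₂ (1 / 2) τ := by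
  rw [← nome_add_one, nomeB_nome]
  refine tsum_congr fun n => ?_
  rw [jacobiTheta₂_term, jacobiTheta₂_term, Complex.exp_eq_exp_iff_exists_int]
  -- The exponents differ by πi n(n - 1), a multiple of 2πi.
  obtain ⟨m, hm⟩ := Int.even_mul_pred_self n
  refine ⟨m, ?_⟩
  have hm' : (n : ℂ) * (n - 1) = m + m := by exact_mod_cast hm
  linear_combination Real.pi * Complex.I * hm'

/-- The modular function `λ` on the upper half-plane. -/
def lam (τ : ℍ) : ℂ := phi (nome τ)

/-- The square of the theta constant `θ₃`. -/
def thetaSq (τ : ℂ) : ℂ := nomeB (nome τ) ^ 2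

theorem nomeB_nome_neg_inv (τ : ℍ) : nomeB (nome τ) =
    1 / (-Complex.I * τ) ^ (1 / 2 : ℂ) * nomeB (nome (-1 / τ)) := by
  rw [nomeB_nome, nomeB_nome, jacobiTheta₂_functional_equation 0 τ]
  simp

theorem thetaSq_neg_inv (τ : ℍ) : thetaSq (-1 / τ) = -Complex.I * τ * thetaSq τ := by
  have h0 : -Complex.I * (τ : ℂ) ≠ 0 := mul_ne_zero (by simp) τ.ne_zero
  have h1 : ((-Complex.I * (τ : ℂ)) ^ (1 / 2 : ℂ)) ^ 2 = -Complex.I * τ := by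
    rw [← Complex.cpow_nat_mul]
    simp
  have h2 : (-Complex.I * (τ : ℂ)) ^ (1 / 2 : ℂ) ≠ 0 := by
    intro h
    rw [h] at h1
    exact h0 (by rw [← h1]; simp)
  rw [thetaSq, thetaSq, nomeB_nome_neg_inv τ, mul_pow, div_pow, h1, one_pow, ← mul_assoc,
    mul_one_div_cancel h0, one_mul]

theorem neg_inv_im_pos (τ : ℍ) : 0 < (-1 / (τ : ℂ)).im := by
  have := UpperHalfPlane.im_inv_neg_coe_pos τ
  rwa [inv_neg, ← one_div, ← neg_div] at this

/-- Under inversion θ₃ reproduces itself and θ₄ turns into θ₂, both with the same factor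
(-iτ)^{-1/2}, which cancels in θ₄⁴/θ₃⁴ = 1 - λ. -/
theorem phi_nome_neg_inv (τ : ℍ) : phi (nome (-1 / τ)) = 1 - phi (nome τ) := by
  have h0 : -Complex.I * (τ : ℂ) ≠ 0 := mul_ne_zero (by simp) τ.ne_zero
  have h2 : (-Complex.I * (τ : ℂ)) ^ (1 / 2 : ℂ) ≠ 0 := by
    rw [Complex.cpow_ne_zero_iff]
    exact Or.inl h0
  have hB := nomeB_ne_zero (norm_nome_lt_one (neg_inv_im_pos τ))
  rw [one_sub_phi (norm_nome_lt_one τ.2), nomeB_nome_neg_inv τ, nomeB_neg_nome,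
    jacobiTheta₂_functional_equation (1 / 2) τ, phi, nomeA_nome]
  have h3 : (1 / 2 : ℂ) / τ = -(-1 / τ / 2) := by ring
  -- The Gaussian factor of the functional equation is the q^{1/4} by which θ₂ exceeds `nomeA`; its
  -- fourth power is the factor z in `phi`.
  have h4 : Complex.exp (-Real.pi * Complex.I * (1 / 2) ^ 2 / τ) ^ 4 = nome (-1 / τ) := by
    rw [nome, ← Complex.exp_nat_mul]
    congr 1
    push_cast
    ring
  rw [h3, jacobiTheta₂_neg_left, mul_pow, mul_pow, mul_pow, h4, mul_assoc,
    mul_div_mul_left _ _ (pow_ne_zero 4 (one_div_ne_zero h2))]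

theorem lam_S_smul (τ : ℍ) : lam (ModularGroup.S • τ) = 1 - lam τ := by
  rw [lam, lam, ← phi_nome_neg_inv, UpperHalfPlane.modular_S_smul]
  congr 2
  rw [UpperHalfPlane.coe_mk, inv_neg, neg_div, one_div]

theorem lam_T_smul (τ : ℍ) : lam (ModularGroup.T • τ) = lam τ / (lam τ - 1) := by
  rw [lam, lam, ← phi_neg (norm_nome_lt_one τ.2), UpperHalfPlane.modular_T_smul, ← nome_add_one]
  congr 2
  rw [UpperHalfPlane.coe_vadd]
  push_cast
  ring

theorem lam_ne_zero (τ : ℍ) : lam τ ≠ 0 := phi_ne_zero (norm_nome_lt_one τ.2) (nome_ne_zero _)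

theorem lam_ne_one (τ : ℍ) : lam τ ≠ 1 := phi_ne_one (norm_nome_lt_one τ.2)

/-! ### The anharmonic group and the action of SL(2, ℤ) on the values of λ -/

/-- The anharmonic group. -/
def anharmonic : Fin 6 → ℂ → ℂ
  | 0, w => w
  | 1, w => 1 - w
  | 2, w => 1 / w
  | 3, w => 1 / (1 - w)
  | 4, w => w / (w - 1)
  | 5, w => (w - 1) / w

theorem anharmonic_ne_zero (i : Fin 6) {w : ℂ} (h0 : w ≠ 0) (h1 : w ≠ 1) :
    anharmonic i w ≠ 0 := by
  have h2 : 1 - w ≠ 0 := sub_ne_zero.2 h1.symm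
  have h3 : w - 1 ≠ 0 := sub_ne_zero.2 h1
  match i with
  | 0 => exact h0
  | 1 => exact h2
  | 2 => exact one_div_ne_zero h0
  | 3 => exact one_div_ne_zero h2
  | 4 => exact div_ne_zero h0 h3
  | 5 => exact div_ne_zero h3 h0

theorem continuousAt_anharmonic (i : Fin 6) {w : ℂ} (h0 : w ≠ 0) (h1 : w ≠ 1) :
    ContinuousAt (anharmonic i) w := by
  have h2 : 1 - w ≠ 0 := sub_ne_zero.2 h1.symm
  have h3 : w - 1 ≠ 0 := sub_ne_zero.2 h1
  have c2 : ContinuousAt (fun w : ℂ => 1 - w) w := by fun_prop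
  have c3 : ContinuousAt (fun w : ℂ => w - 1) w := by fun_prop
  match i with
  | 0 => exact continuousAt_id
  | 1 => exact c2
  | 2 => exact continuousAt_const.div continuousAt_id h0
  | 3 => exact continuousAt_const.div c2 h2
  | 4 => exact continuousAt_id.div c3 h3
  | 5 => exact c3.div continuousAt_id h0

theorem exists_anharmonic_inverse (i : Fin 6) :
    ∃ j, ∀ w, w ≠ 0 → w ≠ 1 → anharmonic j (anharmonic i w) = w := by
  match i with
  | 0 => exact ⟨0, fun w _ _ => rfl⟩
  | 1 => exact ⟨1, fun w _ _ => sub_sub_cancel 1 w⟩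
  | 2 => exact ⟨2, fun w _ _ => one_div_one_div w⟩
  | 3 =>
    refine ⟨5, fun w h0 h1 => ?_⟩
    have h2 : 1 - w ≠ 0 := sub_ne_zero.2 h1.symm
    change (1 / (1 - w) - 1) / (1 / (1 - w)) = w
    field_simp
    ring
  | 4 =>
    refine ⟨4, fun w h0 h1 => ?_⟩
    have h2 : w - 1 ≠ 0 := sub_ne_zero.2 h1
    change w / (w - 1) / (w / (w - 1) - 1) = w
    have : w / (w - 1) - 1 = 1 / (w - 1) := by field_simp; ring
    rw [this]
    field_simp
  | 5 =>
    refine ⟨3, fun w h0 h1 => ?_⟩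
    change 1 / (1 - (w - 1) / w) = w
    have : 1 - (w - 1) / w = 1 / w := by field_simp; ring
    rw [this, one_div_one_div]

theorem exists_anharmonic_one_sub (i : Fin 6) :
    ∃ j, ∀ w, w ≠ 0 → w ≠ 1 → 1 - anharmonic i w = anharmonic j w := by
  match i with
  | 0 => exact ⟨1, fun w _ _ => rfl⟩
  | 1 => exact ⟨0, fun w _ _ => sub_sub_cancel 1 w⟩
  | 2 =>
    refine ⟨5, fun w h0 h1 => ?_⟩
    change 1 - 1 / w = (w - 1) / w
    field_simp
  | 3 =>
    refine ⟨4, fun w h0 h1 => ?_⟩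
    have h2 : 1 - w ≠ 0 := sub_ne_zero.2 h1.symm
    have h3 : w - 1 ≠ 0 := sub_ne_zero.2 h1
    change 1 - 1 / (1 - w) = w / (w - 1)
    field_simp
    ring
  | 4 =>
    refine ⟨3, fun w h0 h1 => ?_⟩
    have h2 : 1 - w ≠ 0 := sub_ne_zero.2 h1.symm
    have h3 : w - 1 ≠ 0 := sub_ne_zero.2 h1
    change 1 - w / (w - 1) = 1 / (1 - w)
    field_simp
    ring
  | 5 =>
    refine ⟨2, fun w h0 h1 => ?_⟩
    change 1 - (w - 1) / w = 1 / w
    field_simp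
    ring

theorem exists_anharmonic_div (i : Fin 6) :
    ∃ j, ∀ w, w ≠ 0 → w ≠ 1 → anharmonic i w / (anharmonic i w - 1) = anharmonic j w := by
  match i with
  | 0 => exact ⟨4, fun w _ _ => rfl⟩
  | 1 =>
    refine ⟨5, fun w h0 h1 => ?_⟩
    change (1 - w) / (1 - w - 1) = (w - 1) / w
    rw [sub_sub_cancel_left, div_neg, ← neg_div, neg_sub]
  | 2 =>
    refine ⟨3, fun w h0 h1 => ?_⟩
    have h2 : 1 - w ≠ 0 := sub_ne_zero.2 h1.symm
    change 1 / w / (1 / w - 1) = 1 / (1 - w)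
    have : 1 / w - 1 = (1 - w) / w := by field_simp
    rw [this]
    field_simp
  | 3 =>
    refine ⟨2, fun w h0 h1 => ?_⟩
    have h2 : 1 - w ≠ 0 := sub_ne_zero.2 h1.symm
    change 1 / (1 - w) / (1 / (1 - w) - 1) = 1 / w
    have : 1 / (1 - w) - 1 = w / (1 - w) := by field_simp; ring
    rw [this]
    field_simp
  | 4 =>
    refine ⟨0, fun w h0 h1 => ?_⟩
    have h2 : w - 1 ≠ 0 := sub_ne_zero.2 h1
    change w / (w - 1) / (w / (w - 1) - 1) = w
    have : w / (w - 1) - 1 = 1 / (w - 1) := by field_simp; ring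
    rw [this]
    field_simp
  | 5 =>
    refine ⟨1, fun w h0 h1 => ?_⟩
    change (w - 1) / w / ((w - 1) / w - 1) = 1 - w
    have : (w - 1) / w - 1 = -1 / w := by field_simp; ring
    rw [this]
    field_simp
    ring

/-- S and T generate SL(2, ℤ) and act on the values by w ↦ 1 - w and w ↦ w/(w - 1), under which the
six anharmonic maps are permuted. The index does not depend on τ, so sections of λ can be
transported by g. -/
theorem exists_lam_smul (g : SL(2, ℤ)) : ∃ i, ∀ τ : ℍ, lam (g • τ) = anharmonic i (lam τ) := by
  have hg : g ∈ Subgroup.closure {ModularGroup.S, ModularGroup.T} := by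
    simp [SpecialLinearGroup.SL2Z_generators]
  induction hg using Subgroup.closure_induction_left with
  | one => exact ⟨0, fun τ => by rw [one_smul]; rfl⟩
  | mul_left x hx y hy ih =>
    obtain ⟨i, hi⟩ := ih
    rcases hx with rfl | rfl
    · obtain ⟨j, hj⟩ := exists_anharmonic_one_sub i
      exact ⟨j, fun τ => by
        rw [mul_smul, lam_S_smul, hi, hj _ (lam_ne_zero τ) (lam_ne_one τ)]⟩
    · obtain ⟨j, hj⟩ := exists_anharmonic_div i
      exact ⟨j, fun τ => by
        rw [mul_smul, lam_T_smul, hi, hj _ (lam_ne_zero τ) (lam_ne_one τ)]⟩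
  | inv_mul_cancel x hx y hy ih =>
    obtain ⟨i, hi⟩ := ih
    rcases hx with rfl | rfl
    · obtain ⟨j, hj⟩ := exists_anharmonic_one_sub i
      refine ⟨j, fun τ => ?_⟩
      have := lam_S_smul ((ModularGroup.S⁻¹ * y) • τ)
      rw [← mul_smul, mul_inv_cancel_left, hi] at this
      rw [← hj _ (lam_ne_zero τ) (lam_ne_one τ), this]
      ring
    · obtain ⟨j, hj⟩ := exists_anharmonic_div i
      refine ⟨j, fun τ => ?_⟩
      have := lam_T_smul ((ModularGroup.T⁻¹ * y) • τ)
      rw [← mul_smul, mul_inv_cancel_left, hi] at this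
      rw [← hj _ (lam_ne_zero τ) (lam_ne_one τ), this]
      generalize hw : lam ((ModularGroup.T⁻¹ * y) • τ) = w
      have h2 : w - 1 ≠ 0 := sub_ne_zero.2 (hw ▸ lam_ne_one _)
      have h3 : w / (w - 1) - 1 = 1 / (w - 1) := by field_simp; ring
      rw [h3]
      field_simp

/-! ### The covering property of λ -/

theorem differentiable_nome : Differentiable ℂ nome := by
  unfold nome
  fun_prop

theorem hasDerivAt_nome (τ : ℂ) : HasDerivAt nome (Real.pi * Complex.I * nome τ) τ := by
  refine ((hasDerivAt_id τ).const_mul (Real.pi * Complex.I)).cexp.congr_deriv ?_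
  simp [nome, mul_comm]

theorem analyticAt_phi {z : ℂ} (hz : ‖z‖ < 1) : AnalyticAt ℂ phi z :=
  analyticOnNhd_phi z (by simpa using hz)

theorem analyticAt_phi_nome {τ : ℂ} (hτ : 0 < τ.im) : AnalyticAt ℂ (phi ∘ nome) τ :=
  (analyticAt_phi (norm_nome_lt_one hτ)).comp (differentiable_nome.analyticAt τ)

theorem deriv_phi_nome_ne_zero {τ : ℂ} (hτ : 0 < τ.im) : deriv (phi ∘ nome) τ ≠ 0 := by
  rw [((differentiableAt_phi (norm_nome_lt_one hτ)).hasDerivAt.comp τ (hasDerivAt_nome τ)).deriv]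
  exact mul_ne_zero (deriv_phi_ne_zero (norm_nome_lt_one hτ))
    (mul_ne_zero (mul_ne_zero (by simp) Complex.I_ne_zero) (nome_ne_zero τ))

theorem isLocalHomeomorph_lam : IsLocalHomeomorph lam :=
  isLocalHomeomorph_comp_of_deriv_ne_zero UpperHalfPlane.isOpenEmbedding_coe
    fun τ => ⟨analyticAt_phi_nome τ.2, deriv_phi_nome_ne_zero τ.2⟩

theorem continuous_lam : Continuous lam := isLocalHomeomorph_lam.continuous

/-- At the cusp i∞ the nome tends to 0 and φ(0) = 0. Hence points of the fundamental domain with |λ|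
≥ c have bounded height. -/
theorem exists_norm_lam_lt {c : ℝ} (hc : 0 < c) : ∃ Y : ℝ, ∀ τ : ℍ, Y < τ.im → ‖lam τ‖ < c := by
  have h1 : ∀ᶠ z in 𝓝 (0 : ℂ), ‖phi z‖ < c := by
    have := (differentiableAt_phi (z := 0) (by simp)).continuousAt.norm
    refine this.eventually (gt_mem_nhds ?_)
    simpa using hc
  obtain ⟨r, hr, h2⟩ := Metric.eventually_nhds_iff.1 h1
  refine ⟨-Real.log r / Real.pi, fun τ hτ => h2 ?_⟩
  rw [dist_zero_right, norm_nome, ← Real.lt_log_iff_exp_lt hr]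
  rw [div_lt_iff₀ Real.pi_pos] at hτ
  have : (τ : ℂ).im = τ.im := rfl
  rw [this]
  linarith

theorem continuous_smul_SL (g : SL(2, ℤ)) : Continuous fun τ : ℍ => g • τ :=
  continuous_const_smul (g : GL (Fin 2) ℝ)

/-- The modular function is a covering of the twice punctured plane. -/
theorem isCoveringMapOn_lam : IsCoveringMapOn lam {w | w ≠ 0 ∧ w ≠ 1} := by
  rintro w₀ ⟨h0, h1⟩
  -- A translate g • τ of a point over w₀ has one of these six values, so a positive c below all of
  -- their norms keeps it away from the cusp.
  have hsmall : ∀ i : Fin 6, ∀ᶠ c in 𝓝[>] (0 : ℝ), c < ‖anharmonic i w₀‖ := fun i =>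
    mem_nhdsWithin_of_mem_nhds (gt_mem_nhds (norm_pos_iff.2 (anharmonic_ne_zero i h0 h1)))
  obtain ⟨c, hc, hc0⟩ := ((eventually_all.2 hsmall).and self_mem_nhdsWithin).exists
  obtain ⟨Y, hY⟩ := exists_norm_lam_lt hc0
  obtain ⟨δ, hδ, hsec⟩ := exists_uniform_sections isLocalHomeomorph_lam
    (ModularGroup.isCompact_truncatedFundamentalDomain Y)
  have hev : ∀ᶠ v in 𝓝 w₀, (v ≠ 0 ∧ v ≠ 1) ∧ ∀ i : Fin 6, c < ‖anharmonic i v‖ ∧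
      dist (anharmonic i v) (anharmonic i w₀) < δ / 2 := by
    refine ((eventually_ne_nhds h0).and (eventually_ne_nhds h1)).and
      (eventually_all.2 fun i => ?_)
    have := continuousAt_anharmonic i h0 h1
    exact (this.norm.eventually (lt_mem_nhds (hc i))).and
      (this.eventually (Metric.ball_mem_nhds _ (half_pos hδ)))
  obtain ⟨r, hr, hball⟩ := Metric.eventually_nhds_iff_ball.1 hev
  refine (isEvenlyCovered_of_sections isLocalHomeomorph_lam Metric.isOpen_ball
    (convex_ball w₀ r).isPreconnected (Metric.mem_ball_self hr) fun τ hτ => ?_)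
  obtain ⟨g, hg⟩ := ModularGroup.exists_smul_mem_fd τ
  obtain ⟨i, hi⟩ := exists_lam_smul g
  obtain ⟨j, hj⟩ := exists_anharmonic_inverse i
  have hgi : ∀ σ : ℍ, lam (g⁻¹ • σ) = anharmonic j (lam σ) := fun σ => by
    have := hi (g⁻¹ • σ)
    rw [smul_inv_smul] at this
    rw [this, hj _ (lam_ne_zero _) (lam_ne_one _)]
  have him : (g • τ).im ≤ Y := by
    by_contra h
    have h2 := hY _ (not_le.1 h)
    rw [hi] at h2
    exact absurd h2 (not_lt.2 ((hball _ hτ).2 i).1.le)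
  obtain ⟨s, hs1, hs2, hs3⟩ := hsec (g • τ) ⟨hg, him⟩
  have hmaps : MapsTo (anharmonic i) (Metric.ball w₀ r) (Metric.ball (lam (g • τ)) δ) := by
    intro v hv
    have h2 := ((hball _ hτ).2 i).2
    have h3 := ((hball _ hv).2 i).2
    rw [Metric.mem_ball, hi]
    have := dist_triangle_right (anharmonic i v) (anharmonic i (lam τ)) (anharmonic i w₀)
    linarith
  -- The uniform section at the representative g • τ, pulled back by g⁻¹ on the source and by the
  -- anharmonic map on the target.
  refine ⟨fun v => g⁻¹ • s (anharmonic i v), ?_, fun v hv => ?_, ?_⟩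
  · refine (continuous_smul_SL g⁻¹).comp_continuousOn (hs1.comp (fun v hv => ?_) hmaps)
    exact (continuousAt_anharmonic i (hball v hv).1.1 (hball v hv).1.2).continuousWithinAt
  · change lam (g⁻¹ • s (anharmonic i v)) = v
    rw [hgi, hs2 _ (hmaps hv), hj v (hball v hv).1.1 (hball v hv).1.2]
  · change g⁻¹ • s (anharmonic i (lam τ)) = τ
    rw [← hi, hs3, inv_smul_smul]

end

section

/-! ### The complete elliptic integral -/

/-- Since 0 ≤ sin² ≤ 1, the product m sin² can lie in [1, ∞) only if m does. -/
theorem one_sub_mul_sin_sq_mem_slitPlane {m : ℂ} (hm : m ∉ Complex.ofReal '' Ici (1 : ℝ)) (t : ℝ) :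
    1 - m * (Real.sin t : ℂ) ^ 2 ∈ Complex.slitPlane := by
  by_contra h
  rw [Complex.mem_slitPlane_iff_not_le_zero, not_not] at h
  obtain ⟨h1, h2⟩ := Complex.le_def.1 h
  rw [← Complex.ofReal_pow] at h1 h2
  simp only [Complex.sub_re, Complex.one_re, Complex.mul_re, Complex.ofReal_re, Complex.ofReal_im,
    mul_zero, sub_zero, Complex.zero_re, Complex.sub_im, Complex.one_im, Complex.mul_im,
    zero_add, Complex.zero_im, zero_sub, neg_eq_zero, mul_eq_zero] at h1 h2
  have h3 : 0 ≤ Real.sin t ^ 2 := sq_nonneg _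
  have h4 : Real.sin t ^ 2 ≤ 1 := Real.sin_sq_le_one t
  rcases h2 with h2 | h2
  · refine hm ⟨m.re, ?_, Complex.ext (by simp) (by simp [h2])⟩
    rw [mem_Ici]
    by_contra h5
    have h6 : Real.sin t ^ 2 = 1 := le_antisymm h4 (by nlinarith)
    rw [h6] at h1
    linarith
  · rw [h2] at h1
    linarith

theorem isOpen_compl_ray : IsOpen (Complex.ofReal '' Ici (1 : ℝ))ᶜ :=
  (Complex.isometry_ofReal.isClosedEmbedding.isClosedMap _ isClosed_Ici).isOpen_compl

theorem continuousOn_kernel (c : ℂ) : ContinuousOn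
    (fun x : ℂ × ℝ => (1 - x.1 * (Real.sin x.2 : ℂ) ^ 2) ^ c)
    ((Complex.ofReal '' Ici (1 : ℝ))ᶜ ×ˢ univ) := by
  refine ContinuousOn.cpow_const ?_ fun x hx => one_sub_mul_sin_sq_mem_slitPlane hx.1 x.2
  fun_prop

theorem continuous_kernel (c : ℂ) {m : ℂ} (hm : m ∉ Complex.ofReal '' Ici (1 : ℝ)) :
    Continuous fun t : ℝ => (1 - m * (Real.sin t : ℂ) ^ 2) ^ c :=
  (continuousOn_kernel c).comp_continuous (f := fun t : ℝ => (m, t)) (by fun_prop)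
    fun _ => ⟨hm, mem_univ _⟩

theorem differentiableAt_ellipticK {m : ℂ} (hm : m ∉ Complex.ofReal '' Ici (1 : ℝ)) :
    DifferentiableAt ℂ ellipticK m := by
  obtain ⟨r, hr, hball⟩ := Metric.nhds_basis_closedBall.mem_iff.1 (isOpen_compl_ray.mem_nhds hm)
  let F' : ℂ → ℝ → ℂ := fun m t => (1 - m * (Real.sin t : ℂ) ^ 2) ^ (-(1 / 2) - 1 : ℂ) *
    ((1 / 2) * (Real.sin t : ℂ) ^ 2)
  have hF' : ContinuousOn (fun x : ℂ × ℝ => F' x.1 x.2)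
      ((Complex.ofReal '' Ici (1 : ℝ))ᶜ ×ˢ univ) :=
    (continuousOn_kernel _).mul (by fun_prop)
  obtain ⟨C, hC⟩ := ((isCompact_closedBall m r).prod
    (isCompact_Icc (a := (0 : ℝ)) (b := Real.pi / 2))).exists_bound_of_continuousOn
    (hF'.mono (prod_mono hball (subset_univ _)))
  have hIcc : uIoc (0 : ℝ) (Real.pi / 2) ⊆ Icc 0 (Real.pi / 2) := by
    rw [uIoc_of_le (by positivity)]
    exact Ioc_subset_Icc_self
  refine (intervalIntegral.hasDerivAt_integral_of_dominated_loc_of_deriv_le (F' := F')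
    (bound := fun _ => C) (Metric.closedBall_mem_nhds m hr) ?_ ?_ ?_ ?_ ?_ ?_).2.differentiableAt
  · filter_upwards [Metric.closedBall_mem_nhds m hr] with x hx
    exact (continuous_kernel _ (hball hx)).aestronglyMeasurable
  · exact (continuous_kernel _ hm).intervalIntegrable _ _
  · exact ((continuous_kernel _ hm).mul (by fun_prop)).aestronglyMeasurable
  · exact Eventually.of_forall fun t ht x hx => hC (x, t) ⟨hx, hIcc ht⟩
  · exact intervalIntegrable_const
  · refine Eventually.of_forall fun t _ x hx => ?_
    have h1 : HasDerivAt (fun x : ℂ => 1 - x * (Real.sin t : ℂ) ^ 2)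
        (-(1 * (Real.sin t : ℂ) ^ 2)) x := ((hasDerivAt_id x).mul_const _).const_sub 1
    refine (h1.cpow_const (one_sub_mul_sin_sq_mem_slitPlane (hball hx) t)).congr_deriv ?_
    simp only [F']
    ring

theorem ellipticK_ofReal {m : ℝ} (hm : m < 1) : ellipticK m =
    ((∫ θ in (0 : ℝ)..(Real.pi / 2), (√(1 - m * Real.sin θ ^ 2))⁻¹ : ℝ) : ℂ) := by
  rw [ellipticK, ← intervalIntegral.integral_ofReal]
  refine intervalIntegral.integral_congr fun θ _ => ?_
  have h1 : 0 ≤ 1 - m * Real.sin θ ^ 2 := by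
    have := Real.sin_sq_le_one θ
    have := sq_nonneg (Real.sin θ)
    nlinarith
  have h2 : (1 : ℂ) - m * (Real.sin θ : ℂ) ^ 2 = ((1 - m * Real.sin θ ^ 2 : ℝ) : ℂ) := by
    push_cast; ring
  have h3 : (-(1 / 2) : ℂ) = ((-(1 / 2) : ℝ) : ℂ) := by push_cast; ring
  rw [h2, h3, ← Complex.ofReal_cpow h1, Real.rpow_neg h1, ← Real.sqrt_eq_rpow]

theorem ellipticK_zero : ellipticK 0 = Real.pi / 2 := by
  simp [ellipticK]

/-- Landen's transformation of the complete elliptic integral. -/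
theorem ellipticK_landen {k : ℝ} (h0 : 0 < k) (h1 : k < 1) :
    ellipticK ((4 * k / (1 + k) ^ 2 : ℝ) : ℂ) = (1 + k) * ellipticK ((k ^ 2 : ℝ) : ℂ) := by
  have hk : 0 < 1 + k := by linarith
  have hm : 4 * k / (1 + k) ^ 2 < 1 := by
    rw [div_lt_one (by positivity)]
    nlinarith [sq_pos_of_pos (sub_pos.2 h1)]
  rw [ellipticK_ofReal hm, ellipticK_ofReal (by nlinarith)]
  suffices h : (∫ θ in (0 : ℝ)..(Real.pi / 2), (√(1 - 4 * k / (1 + k) ^ 2 * Real.sin θ ^ 2))⁻¹) =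
      (1 + k) * ∫ θ in (0 : ℝ)..(Real.pi / 2), (√(1 - k ^ 2 * Real.sin θ ^ 2))⁻¹ by
    rw [h]; push_cast; ring
  -- The substitution is sin u = G(x), which carries [0, π/2] to itself. It makes the radicand 1 -
  -- 4k/(1 + k)² sin² u a perfect square, and f' is du/dx.
  set G : ℝ → ℝ := fun x => (1 + k) * Real.sin x / (1 + k * Real.sin x ^ 2) with hG
  set f' : ℝ → ℝ := fun x => (1 + k) * (1 - k * Real.sin x ^ 2) /
    ((1 + k * Real.sin x ^ 2) * √(1 - k ^ 2 * Real.sin x ^ 2)) with hf'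
  have hs : ∀ x, 0 ≤ Real.sin x ^ 2 ∧ Real.sin x ^ 2 ≤ 1 := fun x =>
    ⟨sq_nonneg _, Real.sin_sq_le_one x⟩
  have hD : ∀ x, 0 < 1 + k * Real.sin x ^ 2 := fun x => by
    have := mul_nonneg h0.le (hs x).1
    linarith
  have hN : ∀ x, 0 < 1 - k * Real.sin x ^ 2 := fun x => by nlinarith [hs x]
  have hR : ∀ x, 0 < 1 - k ^ 2 * Real.sin x ^ 2 := fun x => by
    have : k ^ 2 < 1 := by nlinarith
    nlinarith [hs x]
  have hGsq : ∀ x, 1 - G x ^ 2 =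
      (Real.cos x * √(1 - k ^ 2 * Real.sin x ^ 2) / (1 + k * Real.sin x ^ 2)) ^ 2 := by
    intro x
    have := (hD x).ne'
    simp only [hG]
    field_simp
    rw [Real.sq_sqrt (hR x).le, Real.cos_sq']
    ring
  have hGabs : ∀ x, -1 ≤ G x ∧ G x ≤ 1 := by
    intro x
    have h := hGsq x
    have h2 := sq_nonneg (Real.cos x * √(1 - k ^ 2 * Real.sin x ^ 2) / (1 + k * Real.sin x ^ 2))
    have h3 : G x ^ 2 ≤ 1 := by linarith
    exact abs_le.1 (sq_le_one_iff_abs_le_one _ |>.1 h3)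
  have hGc : Continuous G := by
    refine Continuous.div (by fun_prop) (by fun_prop) fun x => (hD x).ne'
  have hf'c : Continuous f' := by
    refine Continuous.div (by fun_prop) (by fun_prop) fun x => ?_
    exact mul_ne_zero (hD x).ne' (Real.sqrt_pos.2 (hR x)).ne'
  have hgc : Continuous fun u : ℝ => (√(1 - 4 * k / (1 + k) ^ 2 * Real.sin u ^ 2))⁻¹ := by
    refine Continuous.inv₀ (by fun_prop) fun x => (Real.sqrt_pos.2 ?_).ne'
    nlinarith [hs x, show 0 < 4 * k / (1 + k) ^ 2 by positivity]
  -- This form asks for the derivative only in the open interval: G reaches 1 at π/2, where arcsin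
  -- is not differentiable.
  have hsub := intervalIntegral.integral_comp_mul_deriv'' (a := 0) (b := Real.pi / 2)
    (f := fun x => Real.arcsin (G x)) (f' := f')
    (g := fun u => (√(1 - 4 * k / (1 + k) ^ 2 * Real.sin u ^ 2))⁻¹)
    (Real.continuous_arcsin.comp hGc).continuousOn (fun x hx => ?_) hf'c.continuousOn
    hgc.continuousOn
  · have e0 : Real.arcsin (G 0) = 0 := by simp [hG]
    have e1 : Real.arcsin (G (Real.pi / 2)) = Real.pi / 2 := by
      have : G (Real.pi / 2) = 1 := by simp [hG, hk.ne']
      rw [this, Real.arcsin_one]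
    rw [e0, e1] at hsub
    rw [← hsub, ← intervalIntegral.integral_const_mul]
    refine intervalIntegral.integral_congr fun x _ => ?_
    have h2 : 1 - 4 * k / (1 + k) ^ 2 * G x ^ 2 =
        ((1 - k * Real.sin x ^ 2) / (1 + k * Real.sin x ^ 2)) ^ 2 := by
      have := (hD x).ne'
      have := hk.ne'
      rw [hG]
      field_simp
      ring
    simp only [Function.comp_apply]
    rw [Real.sin_arcsin (hGabs x).1 (hGabs x).2, h2,
      Real.sqrt_sq (div_nonneg (hN x).le (hD x).le), hf']
    have e2 := (hD x).ne'
    have e3 := (hN x).ne'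
    have e4 := (Real.sqrt_pos.2 (hR x)).ne'
    field_simp
  · rw [min_eq_left (by positivity), max_eq_right (by positivity)] at hx
    have hc : 0 < Real.cos x := Real.cos_pos_of_mem_Ioo ⟨by linarith [hx.1, Real.pi_pos], hx.2⟩
    have hpos : 0 < Real.cos x * √(1 - k ^ 2 * Real.sin x ^ 2) / (1 + k * Real.sin x ^ 2) :=
      div_pos (mul_pos hc (Real.sqrt_pos.2 (hR x))) (hD x)
    have hlt : 0 < 1 - G x ^ 2 := by rw [hGsq]; positivity
    have hGd : HasDerivAt G ((1 + k) * Real.cos x * (1 - k * Real.sin x ^ 2) /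
        (1 + k * Real.sin x ^ 2) ^ 2) x := by
      have hsin := Real.hasDerivAt_sin x
      refine ((hsin.const_mul (1 + k)).div (((hsin.pow 2).const_mul k).const_add 1)
        (hD x).ne').congr_deriv ?_
      simp only [Pi.pow_apply]
      congr 1
      push_cast
      ring
    have hne1 : G x ≠ -1 := fun h => by rw [h] at hlt; norm_num at hlt
    have hne2 : G x ≠ 1 := fun h => by rw [h] at hlt; norm_num at hlt
    refine (((Real.hasDerivAt_arcsin hne1 hne2).comp x hGd).congr_deriv ?_).hasDerivWithinAt
    rw [hGsq, Real.sqrt_sq hpos.le, hf']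
    have e2 := (hD x).ne'
    have e4 := (Real.sqrt_pos.2 (hR x)).ne'
    have e5 := hc.ne'
    field_simp

end

section

open scoped UpperHalfPlane

/-! ### Elliptic integrals and theta constants -/

theorem exists_sparseSeries_ofReal (e : ℤ → ℕ) (x : ℝ) : ∃ a : ℝ, sparseSeries e x = a :=
  ⟨∑' n : ℤ, x ^ e n, by rw [sparseSeries, Complex.ofReal_tsum]; simp only [Complex.ofReal_pow]⟩

theorem norm_ofReal_lt_one {x : ℝ} (h0 : 0 ≤ x) (h1 : x < 1) : ‖(x : ℂ)‖ < 1 := by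
  rwa [Complex.norm_real, Real.norm_eq_abs, abs_of_nonneg h0]

/-- The theta series are real at real x, and both φ(x) and 1 - φ(x) are built from their fourth
powers. -/
theorem phi_ofReal {x : ℝ} (h0 : 0 ≤ x) (h1 : x < 1) :
    ∃ y : ℝ, phi x = y ∧ 0 ≤ y ∧ y < 1 := by
  have hx := norm_ofReal_lt_one h0 h1
  obtain ⟨a, ha⟩ := exists_sparseSeries_ofReal prExp x
  obtain ⟨b, hb⟩ := exists_sparseSeries_ofReal sqExp x
  obtain ⟨c, hc⟩ := exists_sparseSeries_ofReal sqExp (-x)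
  have hb0 : b ≠ 0 := by
    have := nomeB_ne_zero hx
    rw [nomeB, hb] at this
    exact_mod_cast this
  have hc0 : c ≠ 0 := by
    have := nomeB_ne_zero (z := -x) (by simpa using hx)
    rw [nomeB, ← Complex.ofReal_neg, hc] at this
    exact_mod_cast this
  have h2 := one_sub_phi hx
  refine ⟨x * a ^ 4 / b ^ 4, ?_, by positivity, ?_⟩
  · rw [phi, nomeA, nomeB, ha, hb]
    push_cast
    ring
  · rw [phi, nomeA, nomeB, nomeB, ha, hb, ← Complex.ofReal_neg, hc] at h2
    have h3 : 1 - x * a ^ 4 / b ^ 4 = c ^ 4 / b ^ 4 := by exact_mod_cast h2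
    have h4 : 0 < c ^ 4 / b ^ 4 := by positivity
    linarith

theorem modulus_ofReal {x : ℝ} (h0 : 0 < x) (h1 : x < 1) :
    ∃ k : ℝ, modulus x = k ∧ 0 < k ∧ k < 1 := by
  have hx := norm_ofReal_lt_one h0.le h1
  have hx2 := norm_sq_lt_one hx
  obtain ⟨a, ha⟩ := exists_sparseSeries_ofReal prExp (x ^ 2)
  obtain ⟨b, hb⟩ := exists_sparseSeries_ofReal sqExp (x ^ 2)
  rw [Complex.ofReal_pow] at ha hb
  have ha0 : a ≠ 0 := by
    have := nomeA_ne_zero hx2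
    rw [nomeA, ha] at this
    exact_mod_cast this
  have hb0 : b ≠ 0 := by
    have := nomeB_ne_zero hx2
    rw [nomeB, hb] at this
    exact_mod_cast this
  have hk : modulus x = ((x * a ^ 2 / b ^ 2 : ℝ) : ℂ) := by
    rw [modulus, nomeA, nomeB, ha, hb]
    push_cast
    ring
  have hpos : 0 < x * a ^ 2 / b ^ 2 := by positivity
  refine ⟨_, hk, hpos, ?_⟩
  obtain ⟨y, hy, -, hy1⟩ := phi_ofReal (sq_nonneg x) (by nlinarith)
  have h2 := modulus_sq x
  rw [hk, ← Complex.ofReal_pow x, hy] at h2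
  have h3 : (x * a ^ 2 / b ^ 2) ^ 2 = y := by exact_mod_cast h2
  nlinarith

/-- Passing from x² to x multiplies both K ∘ φ and B² by 1 + k, so their quotient is invariant under
squaring. -/
theorem ellipticK_phi_sq {x : ℝ} (h0 : 0 < x) (h1 : x < 1) :
    ellipticK (phi x) * nomeB ((x : ℂ) ^ 2) ^ 2 = ellipticK (phi ((x : ℂ) ^ 2)) * nomeB x ^ 2 := by
  have hx := norm_ofReal_lt_one h0.le h1
  obtain ⟨k, hk, hk0, hk1⟩ := modulus_ofReal h0 h1
  have h2 := ellipticK_landen hk0 hk1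
  have h3 : phi x = ((4 * k / (1 + k) ^ 2 : ℝ) : ℂ) := by
    rw [phi_eq_modulus hx, hk]; push_cast; ring
  have h4 : phi ((x : ℂ) ^ 2) = ((k ^ 2 : ℝ) : ℂ) := by
    rw [← modulus_sq, hk]; push_cast; ring
  rw [h3, h4, h2, nomeB_sq_eq_modulus hx, hk]
  ring

/-- The elliptic integral as a theta constant, for a real nome. -/
theorem ellipticK_phi_ofReal {x : ℝ} (h0 : 0 < x) (h1 : x < 1) :
    ellipticK (phi x) = Real.pi / 2 * nomeB x ^ 2 := by
  have hpow : ∀ n : ℕ, 0 < x ^ 2 ^ n ∧ x ^ 2 ^ n < 1 := fun n =>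
    ⟨by positivity, pow_lt_one₀ h0.le h1 (by positivity)⟩
  have hB : ∀ n : ℕ, nomeB ((x : ℂ) ^ 2 ^ n) ≠ 0 := fun n => by
    rw [← Complex.ofReal_pow]
    exact nomeB_ne_zero (norm_ofReal_lt_one (hpow n).1.le (hpow n).2)
  have hind : ∀ n : ℕ, ellipticK (phi x) * nomeB ((x : ℂ) ^ 2 ^ n) ^ 2 =
      ellipticK (phi ((x : ℂ) ^ 2 ^ n)) * nomeB x ^ 2 := by
    intro n
    induction n with
    | zero => simp
    | succ n ih =>
      have h := ellipticK_phi_sq (hpow n).1 (hpow n).2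
      rw [Complex.ofReal_pow, ← pow_mul, ← pow_succ] at h
      refine mul_right_cancel₀ (pow_ne_zero 2 (hB n)) ?_
      linear_combination nomeB ((x : ℂ) ^ 2 ^ (n + 1)) ^ 2 * ih + nomeB x ^ 2 * h
  have ht : Tendsto (fun n : ℕ => (x : ℂ) ^ 2 ^ n) atTop (𝓝 0) :=
    (tendsto_pow_atTop_nhds_zero_of_norm_lt_one (norm_ofReal_lt_one h0.le h1)).comp
      (tendsto_pow_atTop_atTop_of_one_lt one_lt_two)
  have hcB : ContinuousAt nomeB 0 := (differentiableAt_nomeB (by simp)).continuousAt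
  have hcK : ContinuousAt (fun z => ellipticK (phi z)) 0 := by
    have h : ContinuousAt ellipticK (phi 0) := by
      rw [phi_zero]
      exact (differentiableAt_ellipticK (notMem_of_norm_lt (by simp))).continuousAt
    exact h.comp (differentiableAt_phi (by simp)).continuousAt
  -- The invariant quotient is evaluated in the limit x^{2ⁿ} → 0, where K(0) = π/2 and B(0) = 1.
  have t1 := ((hcB.tendsto.comp ht).pow 2).const_mul (ellipticK (phi x))
  have t2 := (hcK.tendsto.comp ht).mul_const (nomeB x ^ 2)
  simp only [Function.comp_apply, hind] at t1
  have := tendsto_nhds_unique t1 t2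
  rwa [nomeB_zero, phi_zero, ellipticK_zero, one_pow, mul_one] at this

/-! ### The principal section of the modular function -/

/-- The doubly slit plane. -/
def slitPlane₂ : Set ℂ :=
  {w | w ∉ Complex.ofReal '' Iic (0 : ℝ) ∧ w ∉ Complex.ofReal '' Ici (1 : ℝ)}

theorem mem_slitPlane₂ {w : ℂ} : w ∈ slitPlane₂ ↔ w.im ≠ 0 ∨ 0 < w.re ∧ w.re < 1 := by
  constructor
  · rintro ⟨h1, h2⟩
    by_contra! h
    have hw : ((w.re : ℝ) : ℂ) = w := Complex.ext (by simp) (by simp [h.1])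
    rcases le_or_gt w.re 0 with h3 | h3
    · exact h1 ⟨_, h3, hw⟩
    · exact h2 ⟨_, h.2 h3, hw⟩
  · intro h
    constructor <;> rintro ⟨x, hx, rfl⟩
    · have : x ≤ 0 := hx
      simp only [Complex.ofReal_im, ne_eq, not_true, false_or, Complex.ofReal_re] at h
      linarith
    · have : 1 ≤ x := hx
      simp only [Complex.ofReal_im, ne_eq, not_true, false_or, Complex.ofReal_re] at h
      linarith

theorem isOpen_slitPlane₂ : IsOpen slitPlane₂ :=
  (Complex.isometry_ofReal.isClosedEmbedding.isClosedMap _ isClosed_Iic).isOpen_compl.inter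
    isOpen_compl_ray

theorem half_mem_slitPlane₂ : (1 / 2 : ℂ) ∈ slitPlane₂ :=
  mem_slitPlane₂.2 (Or.inr (by norm_num))

theorem starConvex_slitPlane₂ : StarConvex ℝ (1 / 2 : ℂ) slitPlane₂ := by
  intro w hw a b ha hb hab
  rw [mem_slitPlane₂] at hw ⊢
  have him : (a • (1 / 2 : ℂ) + b • w).im = b * w.im := by simp
  have hre : (a • (1 / 2 : ℂ) + b • w).re = a / 2 + b * w.re := by simp [div_eq_mul_inv]
  rw [him, hre]
  rcases hb.eq_or_lt with rfl | hb
  · right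
    have : a = 1 := by linarith
    subst this
    norm_num
  · rcases hw with hw | hw
    · exact Or.inl (mul_ne_zero hb.ne' hw)
    · right
      constructor <;> nlinarith

theorem isPreconnected_slitPlane₂ : IsPreconnected slitPlane₂ :=
  (starConvex_slitPlane₂.isPathConnected half_mem_slitPlane₂).isConnected.isPreconnected

theorem one_sub_mem_slitPlane₂ {w : ℂ} (hw : w ∈ slitPlane₂) : 1 - w ∈ slitPlane₂ := by
  rw [mem_slitPlane₂] at hw ⊢
  simp only [Complex.sub_im, Complex.one_im, zero_sub, neg_ne_zero, Complex.sub_re, Complex.one_re]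
  rcases hw with h | h
  · exact Or.inl h
  · exact Or.inr ⟨by linarith, by linarith⟩

theorem slitPlane₂_ne {w : ℂ} (hw : w ∈ slitPlane₂) : w ≠ 0 ∧ w ≠ 1 := by
  rw [mem_slitPlane₂] at hw
  constructor <;> rintro rfl <;> simp at hw

theorem S_smul_I : ModularGroup.S • UpperHalfPlane.I = UpperHalfPlane.I := by
  rw [UpperHalfPlane.modular_S_smul]
  ext1
  simp

/-- The point i is fixed by S, hence λ(i) = 1 - λ(i). -/
theorem lam_I : lam UpperHalfPlane.I = 1 / 2 := by
  have := lam_S_smul UpperHalfPlane.I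
  rw [S_smul_I] at this
  linear_combination this / 2

/-- The slit plane is star-shaped about 1/2, hence simply connected, and its inclusion lifts through
the covering λ. -/
theorem exists_slitSection : ∃ s : ℂ → ℍ, ContinuousOn s slitPlane₂ ∧
    (∀ w ∈ slitPlane₂, lam (s w) = w) ∧ s (1 / 2) = UpperHalfPlane.I := by
  classical
  have : ContractibleSpace slitPlane₂ :=
    starConvex_slitPlane₂.contractibleSpace ⟨_, half_mem_slitPlane₂⟩
  have : SimplyConnectedSpace slitPlane₂ := SimplyConnectedSpace.ofContractible _
  have : LocallyPathConnectedSpace slitPlane₂ := isOpen_slitPlane₂.locallyPathConnectedSpace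
  obtain ⟨F, ⟨hF1, hF2⟩, -⟩ := isCoveringMapOn_lam.existsUnique_continuousMap_lifts
    (A := slitPlane₂) ⟨Subtype.val, continuous_subtype_val⟩ (a₀ := ⟨1 / 2, half_mem_slitPlane₂⟩)
    lam_I fun a => slitPlane₂_ne a.2
  have hs : ∀ w (h : w ∈ slitPlane₂),
      (if h : w ∈ slitPlane₂ then F ⟨w, h⟩ else UpperHalfPlane.I) = F ⟨w, h⟩ := fun w h => dif_pos h
  refine ⟨fun w => if h : w ∈ slitPlane₂ then F ⟨w, h⟩ else UpperHalfPlane.I, ?_, ?_, ?_⟩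
  · rw [continuousOn_iff_continuous_domRestrict]
    exact F.continuous.congr fun w => (hs w w.2).symm
  · intro w hw
    simp only [hs w hw]
    exact congrFun hF2 ⟨w, hw⟩
  · exact (hs _ half_mem_slitPlane₂).trans hF1

/-- The section of the modular function over the doubly slit plane which takes the value `i` at
`1 / 2`. -/
def slitSection : ℂ → ℍ := exists_slitSection.choose

theorem continuousOn_slitSection : ContinuousOn slitSection slitPlane₂ :=
  exists_slitSection.choose_spec.1

theorem lam_slitSection {w : ℂ} (hw : w ∈ slitPlane₂) : lam (slitSection w) = w :=
  exists_slitSection.choose_spec.2.1 w hw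

theorem slitSection_half : slitSection (1 / 2) = UpperHalfPlane.I :=
  exists_slitSection.choose_spec.2.2

theorem lam_eqOn {A : Type*} [TopologicalSpace A] {s : Set A} (hs : IsPreconnected s)
    {f g : A → ℍ} (hf : ContinuousOn f s) (hg : ContinuousOn g s)
    (h : ∀ a ∈ s, lam (f a) = lam (g a)) {a : A} (ha : a ∈ s) (hfg : f a = g a) : EqOn f g s :=
  (T2Space.isSeparatedMap lam).eqOn_of_comp_eqOn isLocalHomeomorph_lam.isLocallyInjective hs hf hg
    h ha hfg

/-- Both sides lift w ↦ 1 - w through λ, and they agree at 1/2 because S fixes i. -/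
theorem slitSection_one_sub {w : ℂ} (hw : w ∈ slitPlane₂) :
    slitSection (1 - w) = ModularGroup.S • slitSection w := by
  refine lam_eqOn (f := fun w => slitSection (1 - w)) (g := fun w => ModularGroup.S • slitSection w)
    isPreconnected_slitPlane₂ ?_ ?_ (fun w hw => ?_) half_mem_slitPlane₂ ?_ hw
  · exact continuousOn_slitSection.comp (by fun_prop) fun w hw => one_sub_mem_slitPlane₂ hw
  · exact (continuous_smul_SL _).comp_continuousOn continuousOn_slitSection
  · rw [lam_slitSection (one_sub_mem_slitPlane₂ hw), lam_S_smul, lam_slitSection hw]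
  · rw [slitSection_half, S_smul_I]
    norm_num [slitSection_half]

/-! ### The imaginary axis and the identity K = (π/2) θ₃² -/

/-- The points of the imaginary axis. -/
def imagPoint (u : ℝ) : ℍ := ⟨Complex.I * Real.exp u, by
  rw [Complex.I_mul_im, Complex.ofReal_re]; exact Real.exp_pos u⟩

theorem continuous_imagPoint : Continuous imagPoint := by
  rw [UpperHalfPlane.isEmbedding_coe.continuous_iff]
  change Continuous fun u : ℝ => Complex.I * (Real.exp u : ℂ)
  fun_prop

theorem imagPoint_zero : imagPoint 0 = UpperHalfPlane.I := by
  ext1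
  simp [imagPoint]

theorem nome_imagPoint (u : ℝ) :
    nome (imagPoint u) = (Real.exp (-(Real.pi * Real.exp u)) : ℝ) := by
  change nome (Complex.I * Real.exp u) = _
  have : (Real.pi : ℂ) * Complex.I * (Complex.I * Real.exp u) =
      ((-(Real.pi * Real.exp u) : ℝ) : ℂ) := by
    push_cast
    linear_combination (Real.pi * Complex.exp u) * Complex.I_mul_I
  rw [nome, this, ← Complex.ofReal_exp]

theorem exp_neg_pi_lt_one (u : ℝ) : Real.exp (-(Real.pi * Real.exp u)) < 1 := by
  rw [Real.exp_lt_one_iff, neg_lt_zero]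
  positivity

theorem lam_imagPoint_mem (u : ℝ) : lam (imagPoint u) ∈ slitPlane₂ := by
  obtain ⟨y, hy, hy0, hy1⟩ := phi_ofReal (Real.exp_pos _).le (exp_neg_pi_lt_one u)
  have h0 := lam_ne_zero (imagPoint u)
  rw [lam, nome_imagPoint, hy] at h0 ⊢
  rw [mem_slitPlane₂]
  right
  have : y ≠ 0 := by exact_mod_cast h0
  exact ⟨by simpa using lt_of_le_of_ne hy0 this.symm, by simpa using hy1⟩

/-- On the imaginary axis the nome is real, so λ stays in (0, 1) and uniqueness of lifts, starting
from i, applies. -/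
theorem slitSection_lam_imagPoint (u : ℝ) : slitSection (lam (imagPoint u)) = imagPoint u := by
  refine lam_eqOn (f := fun u => slitSection (lam (imagPoint u))) isPreconnected_univ ?_
    continuous_imagPoint.continuousOn (fun u _ => lam_slitSection (lam_imagPoint_mem u))
    (mem_univ 0) ?_ (mem_univ u)
  · exact continuousOn_slitSection.comp (continuous_lam.comp continuous_imagPoint).continuousOn
      fun u _ => lam_imagPoint_mem u
  · simp only [imagPoint_zero, lam_I, slitSection_half]

/-- Continuous sections of the modular function are analytic. -/
theorem analyticOnNhd_section {ρ : ℂ → ℍ} {V : Set ℂ} (hV : IsOpen V) (hρ : ContinuousOn ρ V)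
    (h : ∀ v ∈ V, lam (ρ v) = v) : AnalyticOnNhd ℂ (fun v => (ρ v : ℂ)) V := by
  refine DifferentiableOn.analyticOnNhd (fun v hv => ?_) hV
  have hc : ContinuousAt (fun v => (ρ v : ℂ)) v :=
    UpperHalfPlane.continuous_coe.continuousAt.comp (hρ.continuousAt (hV.mem_nhds hv))
  have hd := (analyticAt_phi_nome (ρ v).2).differentiableAt.hasDerivAt
  refine (hd.of_local_left_inverse hc (deriv_phi_nome_ne_zero (ρ v).2)
    ?_).differentiableAt.differentiableWithinAt
  filter_upwards [hV.mem_nhds hv] with u hu using h u hu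

theorem differentiableAt_thetaSq {τ : ℂ} (hτ : 0 < τ.im) : DifferentiableAt ℂ thetaSq τ :=
  ((differentiableAt_nomeB (norm_nome_lt_one hτ)).comp τ (differentiable_nome τ)).pow 2

theorem analyticAt_thetaSq {τ : ℂ} (hτ : 0 < τ.im) : AnalyticAt ℂ thetaSq τ :=
  DifferentiableOn.analyticAt (s := {τ | 0 < τ.im})
    (fun _ hσ => (differentiableAt_thetaSq hσ).differentiableWithinAt)
    ((isOpen_lt continuous_const Complex.continuous_im).mem_nhds hτ)

theorem thetaSq_ne_zero (τ : ℍ) : thetaSq τ ≠ 0 :=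
  pow_ne_zero 2 (nomeB_ne_zero (norm_nome_lt_one τ.2))

/-- The elliptic integral as a theta constant. -/
theorem ellipticK_eq_thetaSq {w : ℂ} (hw : w ∈ slitPlane₂) :
    ellipticK w = Real.pi / 2 * thetaSq (slitSection w) := by
  have hK : AnalyticOnNhd ℂ ellipticK slitPlane₂ := DifferentiableOn.analyticOnNhd
    (fun w hw => (differentiableAt_ellipticK hw.2).differentiableWithinAt) isOpen_slitPlane₂
  have hs := analyticOnNhd_section isOpen_slitPlane₂ continuousOn_slitSection
    fun w hw => lam_slitSection hw
  have hT : AnalyticOnNhd ℂ (fun w => Real.pi / 2 * thetaSq (slitSection w)) slitPlane₂ :=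
    fun w hw => analyticAt_const.mul
      (AnalyticAt.fun_comp (analyticAt_thetaSq (slitSection w).2) (hs w hw))
  refine hK.eqOn_of_preconnected_of_frequently_eq hT isPreconnected_slitPlane₂
    half_mem_slitPlane₂ ?_ hw
  -- The identity theorem needs agreement at points accumulating at 1/2 but different from it; λ is
  -- injective on the imaginary axis because the section inverts it there.
  have hc : Tendsto (fun u => lam (imagPoint u)) (𝓝[≠] 0) (𝓝[≠] (1 / 2)) := by
    refine tendsto_nhdsWithin_iff.2 ⟨?_, ?_⟩
    · have := (continuous_lam.comp continuous_imagPoint).tendsto 0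
      simp only [Function.comp_apply, imagPoint_zero, lam_I] at this
      exact this.mono_left nhdsWithin_le_nhds
    · filter_upwards [self_mem_nhdsWithin] with u hu h
      have h1 := slitSection_lam_imagPoint u
      rw [show lam (imagPoint u) = 1 / 2 from h, slitSection_half, ← imagPoint_zero] at h1
      have h2 := congrArg UpperHalfPlane.im h1
      have h3 : ∀ u, (imagPoint u).im = Real.exp u := fun u => by
        change (Complex.I * (Real.exp u : ℂ)).im = _
        rw [Complex.I_mul_im, Complex.ofReal_re]
      rw [h3, h3, Real.exp_eq_exp] at h2
      exact hu h2.symm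
  refine hc.frequently (Eventually.frequently (Eventually.of_forall fun u => ?_))
  rw [slitSection_lam_imagPoint, lam, thetaSq, nome_imagPoint]
  exact ellipticK_phi_ofReal (Real.exp_pos _) (exp_neg_pi_lt_one u)

theorem ellipticK_one_sub_eq_thetaSq {w : ℂ} (hw : w ∈ slitPlane₂) : ellipticK (1 - w) =
    Real.pi / 2 * (-Complex.I * slitSection w * thetaSq (slitSection w)) := by
  rw [ellipticK_eq_thetaSq (one_sub_mem_slitPlane₂ hw), slitSection_one_sub hw, ← thetaSq_neg_inv,
    UpperHalfPlane.modular_S_smul, UpperHalfPlane.coe_mk, inv_neg, neg_div, one_div]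

/-- The theta factors cancel and leave K'/K = -iτ. -/
theorem exp_quotient_eq_nome (τ : ℍ) : Complex.exp (-(Real.pi : ℂ) *
    ((Real.pi / 2 * (-Complex.I * τ * thetaSq τ)) / (Real.pi / 2 * thetaSq τ))) = nome τ := by
  have h1 := thetaSq_ne_zero τ
  have h2 : (Real.pi : ℂ) ≠ 0 := by simp
  rw [nome]
  congr 1
  field_simp

end

section

open scoped UpperHalfPlane

/-! ### The disc and the surface -/

instance : Zero disc := ⟨⟨0, Metric.mem_ball_self one_pos⟩⟩

theorem disc.coe_zero : ((0 : disc) : ℂ) = 0 := rfl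

theorem disc.norm_lt (z : disc) : ‖(z : ℂ)‖ < 1 := mem_ball_zero_iff.1 z.2

theorem disc.ne_zero_iff {z : disc} : z ≠ 0 ↔ (z : ℂ) ≠ 0 := Subtype.coe_ne_coe.symm

/-- The inverse nome on the disc. -/
def phiDisc (z : disc) : ℂ := phi z

theorem isLocalHomeomorph_phiDisc : IsLocalHomeomorph phiDisc :=
  isLocalHomeomorph_comp_of_deriv_ne_zero disc.isOpen.isOpenEmbedding_subtypeVal
    fun z => ⟨analyticAt_phi (disc.norm_lt z), deriv_phi_ne_zero (disc.norm_lt z)⟩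

theorem continuous_phiDisc : Continuous phiDisc := isLocalHomeomorph_phiDisc.continuous

theorem phiDisc_eqOn {A : Type*} [TopologicalSpace A] {s : Set A} (hs : IsPreconnected s)
    {f g : A → disc} (hf : ContinuousOn f s) (hg : ContinuousOn g s)
    (h : ∀ a ∈ s, phiDisc (f a) = phiDisc (g a)) {a : A} (ha : a ∈ s) (hfg : f a = g a) :
    EqOn f g s :=
  (T2Space.isSeparatedMap phiDisc).eqOn_of_comp_eqOn isLocalHomeomorph_phiDisc.isLocallyInjective
    hs hf hg h ha hfg

theorem phiDisc_zero : phiDisc 0 = 0 := phi_zero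

theorem phiDisc_eq_zero_iff {z : disc} : phiDisc z = 0 ↔ z = 0 := by
  refine ⟨fun h => ?_, fun h => h ▸ phiDisc_zero⟩
  by_contra h0
  exact phi_ne_zero (disc.norm_lt z) (disc.ne_zero_iff.1 h0) h

/-- The nome of a point of the upper half-plane, as a point of the disc. -/
def nomeDisc (τ : ℍ) : disc := ⟨nome τ, mem_ball_zero_iff.2 (norm_nome_lt_one τ.2)⟩

theorem continuous_nomeDisc : Continuous nomeDisc :=
  Continuous.subtype_mk (differentiable_nome.continuous.comp UpperHalfPlane.continuous_coe) _

theorem phiDisc_nomeDisc (τ : ℍ) : phiDisc (nomeDisc τ) = lam τ := rfl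

/-- Take τ = log z/(πi); its imaginary part -log|z|/π is positive. -/
theorem exists_nomeDisc_eq {z : disc} (hz : z ≠ 0) : ∃ τ : ℍ, nomeDisc τ = z := by
  have hz0 := disc.ne_zero_iff.1 hz
  have hπ : (Real.pi : ℂ) ≠ 0 := by simp
  have him : 0 < (Complex.log z / (Real.pi * Complex.I)).im := by
    have h1 : Complex.log z / (Real.pi * Complex.I) =
        ((Real.pi⁻¹ : ℝ) : ℂ) * (-Complex.I * Complex.log z) := by
      rw [div_eq_mul_inv, mul_inv, Complex.inv_I]
      push_cast
      ring
    rw [h1, Complex.im_ofReal_mul]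
    have h2 : (-Complex.I * Complex.log z).im = -Real.log ‖(z : ℂ)‖ := by
      simp [Complex.log_re]
    rw [h2]
    have := Real.log_neg (norm_pos_iff.2 hz0) (disc.norm_lt z)
    exact mul_pos (by positivity) (by linarith)
  refine ⟨⟨_, him⟩, Subtype.ext ?_⟩
  change nome (Complex.log z / (Real.pi * Complex.I)) = z
  rw [nome, mul_div_cancel₀ _ (mul_ne_zero hπ Complex.I_ne_zero), Complex.exp_log hz0]

/-! ### Lifting admissible curves -/

theorem isPreconnected_compl_zero : IsPreconnected ({0}ᶜ : Set unitInterval) := by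
  have : ({0}ᶜ : Set unitInterval) = Ioi 0 := by
    ext t
    simp [unitInterval.pos_iff_ne_zero]
  rw [this]
  exact isPreconnected_Ioi

/-- Away from t = 0 the curve avoids 0 and 1, so it lifts through the covering λ. It is first
extended by a constant to (0, ∞), an open convex parameter domain. -/
theorem exists_lift_upper {γ : Curve} (hγ : γ.1 1 ≠ 0) {t₁ : unitInterval} (ht₁ : t₁ ≠ 0)
    {τ₁ : ℍ} (h : lam τ₁ = γ.1 t₁) : ∃ T : unitInterval → ℍ, ContinuousOn T {0}ᶜ ∧
      (∀ t, t ≠ 0 → lam (T t) = γ.1 t) ∧ T t₁ = τ₁ := by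
  classical
  have : ContractibleSpace (Ioi (0 : ℝ)) := (convex_Ioi (0 : ℝ)).contractibleSpace ⟨1, by simp⟩
  have : SimplyConnectedSpace (Ioi (0 : ℝ)) := SimplyConnectedSpace.ofContractible _
  have : LocallyPathConnectedSpace (Ioi (0 : ℝ)) := isOpen_Ioi.locallyPathConnectedSpace
  have hpos : ∀ t : unitInterval, t ≠ 0 → (t : ℝ) ∈ Ioi (0 : ℝ) := fun t ht =>
    unitInterval.pos_iff_ne_zero.2 ht
  let P : Ioi (0 : ℝ) → unitInterval := fun t => projIcc 0 1 zero_le_one (t : ℝ)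
  have hP : ∀ (t : unitInterval) (ht : t ≠ 0), P ⟨t, hpos t ht⟩ = t := fun t _ => projIcc_val zero_le_one t
  have hP0 : ∀ t, P t ≠ 0 := by
    intro t h0
    have h1 : ((P t : unitInterval) : ℝ) = 0 := by rw [h0]; rfl
    rw [coe_projIcc] at h1
    have h2 : 0 < min 1 (t : ℝ) := lt_min one_pos t.2
    exact absurd h1 (lt_max_of_lt_right h2).ne'
  obtain ⟨F, ⟨hF1, hF2⟩, -⟩ := isCoveringMapOn_lam.existsUnique_continuousMap_lifts
    (A := Ioi (0 : ℝ)) ⟨fun t => γ.1 (P t), by fun_prop⟩ (a₀ := ⟨t₁, hpos t₁ ht₁⟩) (e₀ := τ₁)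
    (by simpa [hP t₁ ht₁] using h) fun t => γ.ne_of_end hγ _ (hP0 t)
  have hT : ∀ (t : unitInterval) (ht : t ≠ 0), (if ht : t ≠ 0 then F ⟨t, hpos t ht⟩ else τ₁) = F ⟨t, hpos t ht⟩ :=
    fun t ht => dif_pos ht
  refine ⟨fun t => if ht : t ≠ 0 then F ⟨t, hpos t ht⟩ else τ₁, ?_, fun t ht => ?_, ?_⟩
  · rw [continuousOn_iff_continuous_domRestrict]
    have hc : Continuous fun t : ({0}ᶜ : Set unitInterval) => F ⟨t.1, hpos t t.2⟩ := by fun_prop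
    exact hc.congr fun t => (hT t.1 t.2).symm
  · simp only [hT t ht]
    have := congrFun hF2 ⟨t, hpos t ht⟩
    simpa [hP t ht] using this
  · exact (hT t₁ ht₁).trans hF1

/-- The covering λ says nothing at the start 0, where φ is only known to be locally invertible. The
lift is the local inverse there, continued by the nome of a lift to the upper half-plane. -/
theorem exists_lift (γ : Curve) :
    ∃ Γ : C(unitInterval, disc), Γ 0 = 0 ∧ ∀ t, phiDisc (Γ t) = γ.1 t := by
  classical
  rcases eq_or_ne (γ.1 1) 0 with hγ | hγ
  · have hz : ∀ t, γ.1 t = 0 := γ.2.2.resolve_right fun h' => (h' 1 (by simp)).1 hγ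
    exact ⟨.const _ 0, rfl, fun t => by rw [hz t]; exact phiDisc_zero⟩
  obtain ⟨e, he0, he⟩ := isLocalHomeomorph_phiDisc 0
  have heφ : ∀ z, e z = phiDisc z := fun z => by rw [he]
  have htarget : (0 : ℂ) ∈ e.target := by
    have := e.map_source he0
    rwa [heφ, phiDisc_zero] at this
  have hsymm0 : e.symm 0 = 0 := by
    have := e.left_inv he0
    rwa [heφ, phiDisc_zero] at this
  obtain ⟨ε, hε0, hε⟩ : ∃ ε : unitInterval, 0 < ε ∧ ∀ t, t ≤ ε → γ.1 t ∈ e.target := by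
    have h1 : ∀ᶠ t in 𝓝 (0 : unitInterval), γ.1 t ∈ e.target :=
      γ.1.continuous.continuousAt.eventually (e.open_target.mem_nhds (by rwa [γ.2.1]))
    obtain ⟨u, hu, hu'⟩ := exists_Ico_subset_of_mem_nhds h1 ⟨1, zero_lt_one⟩
    obtain ⟨ε, h2, h3⟩ := exists_between hu
    exact ⟨ε, h2, fun t ht => hu' ⟨t.2.1, ht.trans_lt h3⟩⟩
  have hφs : ∀ t, t ≤ ε → phiDisc (e.symm (γ.1 t)) = γ.1 t := fun t ht => by
    rw [← heφ]; exact e.right_inv (hε t ht)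
  have hz : e.symm (γ.1 ε) ≠ 0 := fun h => by
    have h1 := hφs ε le_rfl
    rw [h, phiDisc_zero] at h1
    exact (γ.ne_of_end hγ ε hε0.ne').1 h1.symm
  obtain ⟨τ₁, hτ₁⟩ := exists_nomeDisc_eq hz
  obtain ⟨T, hTc, hT, hTε⟩ := exists_lift_upper hγ hε0.ne' (τ₁ := τ₁)
    (by rw [← phiDisc_nomeDisc, hτ₁, hφs ε le_rfl])
  -- The two lifts agree at ε by the choice of τ₁, hence on (0, ε]; this gives continuity at 0 of
  -- the glued curve.
  have hloc : EqOn (fun t => nomeDisc (T t)) (fun t => e.symm (γ.1 t)) (Ioc 0 ε) := by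
    refine phiDisc_eqOn isPreconnected_Ioc
      (continuous_nomeDisc.comp_continuousOn (hTc.mono fun t ht => ht.1.ne'))
      (e.continuousOn_symm.comp γ.1.continuous.continuousOn fun t ht => hε t ht.2)
      (fun t ht => ?_) (a := ε) ⟨hε0, le_rfl⟩ ?_
    · rw [phiDisc_nomeDisc, hT t ht.1.ne', hφs t ht.2]
    · simp only [hTε, hτ₁]
  refine ⟨⟨fun t => if t = 0 then 0 else nomeDisc (T t), ?_⟩, if_pos rfl, fun t => ?_⟩
  · rw [continuous_iff_continuousAt]
    intro t
    by_cases ht : t = 0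
    · subst ht
      have hc : ContinuousAt (fun t => e.symm (γ.1 t)) 0 := by
        refine ContinuousAt.comp (g := e.symm) ?_ γ.1.continuous.continuousAt
        exact e.continuousAt_symm (by rwa [γ.2.1])
      refine hc.congr ?_
      filter_upwards [Iio_mem_nhds hε0] with t ht
      by_cases h0 : t = 0
      · simp [h0, γ.2.1, hsymm0]
      · simp only [h0, if_false]
        exact (hloc ⟨unitInterval.pos_iff_ne_zero.2 h0, le_of_lt ht⟩).symm
    · have hc : ContinuousAt (fun t => nomeDisc (T t)) t :=
        continuous_nomeDisc.continuousAt.comp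
          (hTc.continuousAt (isOpen_compl_singleton.mem_nhds ht))
      refine hc.congr ?_
      filter_upwards [isOpen_compl_singleton.mem_nhds ht] with u hu
      exact (if_neg hu).symm
  · by_cases ht : t = 0
    · simp [ht, γ.2.1, phiDisc_zero]
    · simp only [ContinuousMap.coe_mk, ht, if_false]
      rw [phiDisc_nomeDisc, hT t ht]

theorem lift_unique {Γ Γ' : C(unitInterval, disc)} (h0 : Γ 0 = Γ' 0)
    (h : ∀ t, phiDisc (Γ t) = phiDisc (Γ' t)) : Γ = Γ' :=
  ContinuousMap.ext fun t => phiDisc_eqOn isPreconnected_univ Γ.continuous.continuousOn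
    Γ'.continuous.continuousOn (fun t _ => h t) (mem_univ 0) h0 (mem_univ t)

/-- Every intermediate curve of the homotopy is admissible and so has a lift from 0. The monodromy
theorem for local homeomorphisms then needs no covering property at 0. -/
theorem lift_end_eq {γ γ' : Curve} (h : γ ≈ γ') {Γ Γ' : C(unitInterval, disc)} (h0 : Γ 0 = 0)
    (h0' : Γ' 0 = 0) (hΓ : ∀ t, phiDisc (Γ t) = γ.1 t) (hΓ' : ∀ t, phiDisc (Γ' t) = γ'.1 t) :
    Γ 1 = Γ' 1 := by
  obtain ⟨H⟩ := h
  have hcur : ∀ s, IsCurve (H.toHomotopy.curry s) := fun s => (H.prop s).1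
  have hend : ∀ s, H.toHomotopy.curry s 1 = γ.1 1 := fun s => (H.prop s).2
  choose L hL0 hL using fun s => exists_lift ⟨_, hcur s⟩
  let R : ContinuousMap.HomotopyRel γ.1 γ'.1 {0, 1} := ⟨H.toHomotopy, fun s x hx => by
    rcases hx with rfl | rfl
    · exact (hcur s).1.trans γ.2.1.symm
    · exact hend s⟩
  have hmon := isLocalHomeomorph_phiDisc.monodromy_theorem (T2Space.isSeparatedMap phiDisc) R L
    (fun s t => hL s t) (fun s => by rw [hL0, hL0]) 1
  have e0 : L 0 = Γ := lift_unique (by rw [hL0, h0]) fun t => by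
    rw [hL, hΓ]; exact H.apply_zero t
  have e1 : L 1 = Γ' := lift_unique (by rw [hL0, h0']) fun t => by
    rw [hL, hΓ']; exact H.apply_one t
  rw [← e0, ← e1, hmon]

/-- A curve in the disc that leaves the origin at once can be straightened through such curves. -/
theorem exists_disc_homotopy (Γ : C(unitInterval, disc)) (h0 : Γ 0 = 0)
    (hne : ∀ t, t ≠ 0 → Γ t ≠ 0) : ∃ F : C(unitInterval × unitInterval, disc),
      (∀ t, (F (0, t) : ℂ) = (t : ℝ) * (Γ 1 : ℂ)) ∧ (∀ t, F (1, t) = Γ t) ∧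
      (∀ s, F (s, 1) = Γ 1) ∧ (∀ s, F (s, 0) = 0) ∧ ∀ s t, t ≠ 0 → F (s, t) ≠ 0 := by
  classical
  have hz : (Γ 1 : ℂ) ≠ 0 := disc.ne_zero_iff.1 (hne 1 (by simp))
  have hne' : ∀ t, t ≠ 0 → (Γ t : ℂ) ≠ 0 := fun t ht => disc.ne_zero_iff.1 (hne t ht)
  have hseg : ∀ t : unitInterval, t ≠ 0 → segMap (Γ 1) t ≠ 0 := fun t ht =>
    mul_ne_zero (Complex.ofReal_ne_zero.2 fun h => ht (Subtype.ext h)) hz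
  have hseg1 : ∀ t : unitInterval, ‖segMap (Γ 1) t‖ < 1 := fun t => by
    have h2 : ‖segMap (Γ 1) t‖ = (t : ℝ) * ‖(Γ 1 : ℂ)‖ := by
      simp [segMap, abs_of_nonneg t.2.1]
    rw [h2]
    exact (mul_le_of_le_one_left (norm_nonneg _) t.2.2).trans_lt (disc.norm_lt (Γ 1))
  obtain ⟨D, hD, hD1, hDe⟩ := logLift ⟨fun t => (Γ t : ℂ), by fun_prop⟩ (segMap (Γ 1)) hne' hseg
    (by simp [segMap])
  have hΓ : ∀ t, t ≠ 0 → (Γ t : ℂ) = segMap (Γ 1) t * Complex.exp (D t) := hDe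
  -- Geometric interpolation between the segment and Γ. It vanishes only at t = 0, and its modulus
  -- never exceeds the larger of the two ends. This keeps it in the disc and gives continuity at t =
  -- 0, where D need not be bounded.
  set F : unitInterval × unitInterval → ℂ := fun x =>
    if x.2 = 0 then 0 else segMap (Γ 1) x.2 * Complex.exp ((x.1 : ℝ) * D x.2) with hF
  have hbound : ∀ x, ‖F x‖ ≤ max ‖segMap (Γ 1) x.2‖ ‖(Γ x.2 : ℂ)‖ := by
    intro ⟨s, t⟩
    by_cases ht : t = 0
    · simp [hF, ht]
    · simp only [hF, ht, if_false, hΓ t ht, norm_mul, Complex.norm_exp]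
      have h1 : (((s : ℝ) : ℂ) * D t).re = s * (D t).re := by simp
      rw [h1]
      rcases le_total 0 (D t).re with h | h
      · refine le_max_of_le_right ?_
        gcongr
        exact mul_le_of_le_one_left h s.2.2
      · refine le_max_of_le_left ?_
        refine mul_le_of_le_one_right (norm_nonneg _) ?_
        exact Real.exp_le_one_iff.2 (mul_nonpos_of_nonneg_of_nonpos s.2.1 h)
  have hFc : Continuous F := by
    rw [continuous_iff_continuousAt]
    rintro ⟨s, t⟩
    by_cases ht : t = 0
    · subst ht
      have hz : F (s, 0) = 0 := by simp [hF]
      rw [ContinuousAt, hz]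
      refine squeeze_zero_norm hbound ?_
      have hc : Continuous fun x : unitInterval × unitInterval =>
          max ‖segMap (Γ 1) x.2‖ ‖(Γ x.2 : ℂ)‖ := by fun_prop
      have := hc.tendsto (s, 0)
      simpa [segMap, h0, disc.coe_zero] using this
    · have hev : F =ᶠ[𝓝 (s, t)] fun x =>
          segMap (Γ 1) x.2 * Complex.exp ((x.1 : ℝ) * D x.2) := by
        have : ∀ᶠ x : unitInterval × unitInterval in 𝓝 (s, t), x.2 ≠ 0 :=
          continuousAt_snd.eventually_ne ht
        filter_upwards [this] with x hx
        simp [hF, hx]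
      refine ContinuousAt.congr ?_ hev.symm
      have hDt : ContinuousAt (fun x : unitInterval × unitInterval => D x.2) (s, t) :=
        ContinuousAt.comp (f := Prod.snd) (x := (s, t))
          (hD.continuousAt (isOpen_compl_singleton.mem_nhds ht)) continuousAt_snd
      have hs : ContinuousAt (fun x : unitInterval × unitInterval => ((x.1 : ℝ) : ℂ)) (s, t) :=
        Continuous.continuousAt (by fun_prop)
      have hη₀ : ContinuousAt (fun x : unitInterval × unitInterval => segMap (Γ 1) x.2) (s, t) :=
        Continuous.continuousAt (by fun_prop)
      exact hη₀.mul (hs.mul hDt).cexp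
  have hF1 : ∀ x, F x ∈ disc := fun x =>
    mem_ball_zero_iff.2 ((hbound x).trans_lt (max_lt (hseg1 _) (disc.norm_lt (Γ x.2))))
  refine ⟨⟨fun x => ⟨F x, hF1 x⟩, hFc.subtype_mk _⟩, fun t => ?_, fun t => Subtype.ext ?_,
    fun s => Subtype.ext ?_, fun s => Subtype.ext ?_, fun s t ht => disc.ne_zero_iff.2 ?_⟩
  · by_cases ht : t = 0
    · simp [hF, ht]
    · simp [hF, ht, segMap]
  · by_cases ht : t = 0
    · simp [hF, ht, h0, disc.coe_zero]
    · simp [hF, ht, hΓ t ht]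
  · simp [hF, hD1, segMap]
  · simp [hF, disc.coe_zero]
  · simp only [hF, ContinuousMap.coe_mk, ht, if_false]
    exact mul_ne_zero (hseg t ht) (Complex.exp_ne_zero _)

/-! ### Uniformization -/

/-- The ray from `0` to a point of the disc. -/
def ray (z : disc) : C(unitInterval, disc) :=
  ⟨fun t => ⟨(t : ℝ) * (z : ℂ), mem_ball_zero_iff.2 (by
    rw [norm_mul, Complex.norm_real, Real.norm_eq_abs, abs_of_nonneg t.2.1]
    exact (mul_le_of_le_one_left (norm_nonneg _) t.2.2).trans_lt (disc.norm_lt z))⟩,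
    Continuous.subtype_mk (by fun_prop) _⟩

theorem ray_zero (z : disc) : ray z 0 = 0 := Subtype.ext (by simp [ray, disc.coe_zero])

theorem ray_one (z : disc) : ray z 1 = z := Subtype.ext (by simp [ray])

theorem isCurve_phiDisc {Γ : C(unitInterval, disc)} (h0 : Γ 0 = 0)
    (h : (∀ t, Γ t = 0) ∨ ∀ t, t ≠ 0 → Γ t ≠ 0) :
    IsCurve ⟨fun t => phiDisc (Γ t), continuous_phiDisc.comp Γ.continuous⟩ := by
  refine ⟨by simp [h0, phiDisc_zero], h.imp (fun h t => ?_) fun h t ht => ⟨?_, ?_⟩⟩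
  · simp [h t, phiDisc_zero]
  · exact fun h1 => h t ht (phiDisc_eq_zero_iff.1 h1)
  · exact phi_ne_one (disc.norm_lt (Γ t))

theorem ray_dichotomy (z : disc) : (∀ t, ray z t = 0) ∨ ∀ t, t ≠ 0 → ray z t ≠ 0 := by
  by_cases hz : (z : ℂ) = 0
  · exact Or.inl fun t => Subtype.ext (by simp [ray, hz, disc.coe_zero])
  · refine Or.inr fun t ht => disc.ne_zero_iff.2 ?_
    exact mul_ne_zero (Complex.ofReal_ne_zero.2 fun h => ht (Subtype.ext h)) hz

/-- The image of a ray under the inverse nome. -/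
def rayCurve (z : disc) : Curve := ⟨_, isCurve_phiDisc (ray_zero z) (ray_dichotomy z)⟩

/-- The uniformization of the surface by the disc. -/
def toSurface (z : disc) : Surface := Surface.mk (rayCurve z)

theorem proj_toSurface (z : disc) : Surface.proj (toSurface z) = phiDisc z := by
  change phiDisc (ray z 1) = _
  rw [ray_one]

theorem continuous_toSurface : Continuous toSurface := by
  refine Surface.continuous_mk.comp (Continuous.subtype_mk ?_ _)
  refine ContinuousMap.continuous_of_continuous_uncurry _ ?_
  change Continuous fun x : disc × unitInterval => phiDisc (ray x.1 x.2)
  refine continuous_phiDisc.comp ?_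
  refine Continuous.subtype_mk (f := fun x : disc × unitInterval =>
    ((x.2 : ℝ) : ℂ) * (x.1 : ℂ)) (by fun_prop) _

/-- The straightening of Γ to a ray, pushed forward by φ, is a homotopy through admissible curves,
because φ vanishes only at 0 and omits 1. -/
theorem toSurface_lift {γ : Curve} {Γ : C(unitInterval, disc)} (h0 : Γ 0 = 0)
    (hΓ : ∀ t, phiDisc (Γ t) = γ.1 t) : toSurface (Γ 1) = Surface.mk γ := by
  by_cases h1 : Γ 1 = 0
  · have hγ : γ.1 1 = 0 := by rw [← hΓ, h1, phiDisc_zero]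
    have hz : ∀ t, γ.1 t = 0 := γ.2.2.resolve_right fun h' => (h' 1 (by simp)).1 hγ
    have : rayCurve (Γ 1) = γ := Subtype.ext <| ContinuousMap.ext fun t => by
      change phiDisc (ray (Γ 1) t) = _
      rw [hz t, h1, phiDisc_eq_zero_iff]
      exact Subtype.ext (by simp [ray, disc.coe_zero])
    rw [toSurface, this]
  · have hγ : γ.1 1 ≠ 0 := by rwa [← hΓ, Ne, phiDisc_eq_zero_iff]
    have hne : ∀ t, t ≠ 0 → Γ t ≠ 0 := fun t ht h => by
      have := (γ.ne_of_end hγ t ht).1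
      rw [← hΓ, h] at this
      exact this phiDisc_zero
    obtain ⟨F, hF0, hF1, hFe, hFs, hFn⟩ := exists_disc_homotopy Γ h0 hne
    refine Quotient.sound ⟨⟨⟨⟨fun x => phiDisc (F x), continuous_phiDisc.comp F.continuous⟩,
      fun t => ?_, fun t => ?_⟩, fun s => ⟨?_, ?_⟩⟩⟩
    · exact congrArg phiDisc (Subtype.ext (hF0 t))
    · change phiDisc (F (1, t)) = γ.1 t
      rw [hF1, hΓ]
    · exact isCurve_phiDisc (Γ := F.comp ⟨fun t => (s, t), by fun_prop⟩) (hFs s)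
        (Or.inr fun t ht => hFn s t ht)
    · change phiDisc (F (s, 1)) = phiDisc (ray (Γ 1) 1)
      rw [hFe, ray_one]

theorem toSurface_bijective : Function.Bijective toSurface := by
  constructor
  · intro z z' h
    have := lift_end_eq (Quotient.exact h) (ray_zero z) (ray_zero z') (fun _ => rfl) fun _ => rfl
    rwa [ray_one, ray_one] at this
  · rintro ⟨γ⟩
    obtain ⟨Γ, h0, hΓ⟩ := exists_lift γ
    exact ⟨Γ 1, toSurface_lift h0 hΓ⟩

theorem isLocalHomeomorph_toSurface : IsLocalHomeomorph toSurface := by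
  refine IsLocalHomeomorph.of_comp ?_ Surface.isLocalHomeomorph_proj continuous_toSurface
  rw [show Surface.proj ∘ toSurface = phiDisc from funext proj_toSurface]
  exact isLocalHomeomorph_phiDisc

end

section

open scoped UpperHalfPlane

/-! ### The Riemann surface structure -/

theorem analyticOnNhd_phiDisc_section {ρ : ℂ → disc} {V : Set ℂ} (hV : IsOpen V)
    (hρ : ContinuousOn ρ V) (h : ∀ v ∈ V, phiDisc (ρ v) = v) :
    AnalyticOnNhd ℂ (fun v => (ρ v : ℂ)) V := by
  refine DifferentiableOn.analyticOnNhd (fun v hv => ?_) hV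
  have hc : ContinuousAt (fun v => (ρ v : ℂ)) v :=
    continuous_subtype_val.continuousAt.comp (hρ.continuousAt (hV.mem_nhds hv))
  have hd := (differentiableAt_phi (disc.norm_lt (ρ v))).hasDerivAt
  refine (hd.of_local_left_inverse hc (deriv_phi_ne_zero (disc.norm_lt (ρ v)))
    ?_).differentiableAt.differentiableWithinAt
  filter_upwards [hV.mem_nhds hv] with u hu using h u hu

/-- The nome, as a homeomorphism from the surface to the disc. -/
def nomeHomeomorph : Surface ≃ₜ disc :=
  (isLocalHomeomorph_toSurface.toHomeomorphOfBijective toSurface_bijective).symm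

theorem nomeHomeomorph_toSurface (z : disc) : nomeHomeomorph (toSurface z) = z :=
  nomeHomeomorph.apply_symm_apply z

theorem phiDisc_nomeHomeomorph (x : Surface) : phiDisc (nomeHomeomorph x) = Surface.proj x := by
  obtain ⟨z, rfl⟩ := toSurface_bijective.2 x
  rw [nomeHomeomorph_toSurface, proj_toSurface]

theorem coe_chartAt_surface (x : Surface) : (chartAt ℂ x : Surface → ℂ) = Surface.proj :=
  (Surface.isLocalHomeomorph_proj x).choose_spec.2.symm

theorem contMDiff_toSurface : ContMDiff 𝓘(ℂ, ℂ) 𝓘(ℂ, ℂ) ω toSurface := fun z => by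
  refine contMDiffAt_iff_target.2 ⟨continuous_toSurface.continuousAt, ?_⟩
  -- The charts are the endpoint projection, so the map reads as φ in them; its inverse reads as a
  -- local section of φ.
  have h : extChartAt 𝓘(ℂ, ℂ) (toSurface z) ∘ toSurface = fun z : disc => phi z := by
    ext u
    simp only [mfld_simps, coe_chartAt_surface, proj_toSurface]
    rfl
  rw [h]
  exact contMDiffAt_subtype_iff.2 (analyticAt_phi (disc.norm_lt z)).contDiffAt.contMDiffAt

theorem contMDiff_nomeHomeomorph : ContMDiff 𝓘(ℂ, ℂ) 𝓘(ℂ, ℂ) ω nomeHomeomorph := fun x => by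
  refine contMDiffAt_iff_target.2 ⟨nomeHomeomorph.continuous.continuousAt, ?_⟩
  refine contMDiffAt_iff_source.2 ?_
  refine ContMDiffAt.contMDiffWithinAt (ContDiffAt.contMDiffAt ?_)
  have hs := analyticOnNhd_phiDisc_section (chartAt ℂ x).open_target
    (nomeHomeomorph.continuous.comp_continuousOn (chartAt ℂ x).continuousOn_symm) fun v hv => by
      rw [Function.comp_apply, phiDisc_nomeHomeomorph, ← coe_chartAt_surface x]
      exact (chartAt ℂ x).right_inv hv
  have := (hs _ (mem_chart_target ℂ x)).contDiffAt (n := ω)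
  simp only [mfld_simps] at this ⊢
  exact this

/-- The nome as a biholomorphic map. -/
def nomeDiffeomorph : Surface ≃ₘ^ω⟮𝓘(ℂ, ℂ), 𝓘(ℂ, ℂ)⟯ disc :=
  ⟨nomeHomeomorph.toEquiv, contMDiff_nomeHomeomorph, contMDiff_toSurface⟩

theorem nomeDiffeomorph_toSurface (z : disc) : nomeDiffeomorph (toSurface z) = z :=
  nomeHomeomorph_toSurface z

theorem nomeDiffeomorph_lift {γ : Curve} {Γ : C(unitInterval, disc)} (h0 : Γ 0 = 0)
    (hΓ : ∀ t, phiDisc (Γ t) = γ.1 t) : nomeDiffeomorph (Surface.mk γ) = Γ 1 := by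
  rw [← toSurface_lift h0 hΓ, nomeDiffeomorph_toSurface]

theorem proj_nomeDiffeomorph_symm (z : disc) :
    Surface.proj (nomeDiffeomorph.symm z) = phi z := proj_toSurface z

theorem nomeDiffeomorph_origin : nomeDiffeomorph Surface.origin = 0 :=
  nomeDiffeomorph_lift (Γ := .const _ 0) rfl fun t => by
    simp [segMap, phiDisc_zero]

/-! ### The first sheet -/

theorem continuous_seg : Continuous fun w : slitPlane₂ => Surface.seg w w.2.2 := by
  refine Surface.continuous_mk.comp (Continuous.subtype_mk ?_ _)
  refine ContinuousMap.continuous_of_continuous_uncurry _ ?_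
  change Continuous fun x : slitPlane₂ × unitInterval => ((x.2 : ℝ) : ℂ) * x.1
  fun_prop

theorem norm_segMap_lt {w : ℂ} (hw : ‖w‖ < 1) (t : unitInterval) : ‖segMap w t‖ < 1 := by
  have h2 : ‖segMap w t‖ = (t : ℝ) * ‖w‖ := by simp [segMap, abs_of_nonneg t.2.1]
  rw [h2]
  exact (mul_le_of_le_one_left (norm_nonneg _) t.2.2).trans_lt hw

/-- This anchors the first sheet. The segment to 1/2 and the φ-image of the ray to e^{-π} both stay
in the unit disc, the latter because φ maps [0, 1) into [0, 1). There, admissible curves with equal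
endpoints are homotopic. -/
theorem toSurface_nomeDisc_I :
    toSurface (nomeDisc UpperHalfPlane.I) = Surface.seg (1 / 2) half_mem_slitPlane₂.2 := by
  refine (Quotient.sound (homotopic_of_norm_lt ?_ ?_ ?_)).symm
  · exact norm_segMap_lt (by norm_num)
  · intro t
    have h1 : ((ray (nomeDisc UpperHalfPlane.I) t : disc) : ℂ) =
        ((t * Real.exp (-(Real.pi * Real.exp 0)) : ℝ) : ℂ) := by
      change ((t : ℝ) : ℂ) * nome UpperHalfPlane.I = _
      rw [← imagPoint_zero, nome_imagPoint]
      push_cast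
      rfl
    have h2 : 0 ≤ (t : ℝ) * Real.exp (-(Real.pi * Real.exp 0)) :=
      mul_nonneg t.2.1 (Real.exp_pos _).le
    have h3 : (t : ℝ) * Real.exp (-(Real.pi * Real.exp 0)) < 1 :=
      (mul_le_of_le_one_left (Real.exp_pos _).le t.2.2).trans_lt (exp_neg_pi_lt_one 0)
    obtain ⟨y, hy, hy0, hy1⟩ := phi_ofReal h2 h3
    change ‖phi (ray (nomeDisc UpperHalfPlane.I) t : disc)‖ < 1
    rw [h1, hy]
    exact norm_ofReal_lt_one hy0 hy1
  · change phiDisc (ray _ 1) = segMap (1 / 2) 1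
    rw [ray_one, phiDisc_nomeDisc, lam_I]
    simp [segMap]

/-- Both sides lift the inclusion of the connected slit plane through φ, and they agree at 1/2. -/
theorem nomeDiffeomorph_seg {w : ℂ} (hw : w ∈ slitPlane₂) :
    nomeDiffeomorph (Surface.seg w hw.2) = nomeDisc (slitSection w) := by
  have : PreconnectedSpace slitPlane₂ := Subtype.preconnectedSpace isPreconnected_slitPlane₂
  refine phiDisc_eqOn (A := slitPlane₂) (s := univ)
    (f := fun w => nomeDiffeomorph (Surface.seg w w.2.2))
    (g := fun w => nomeDisc (slitSection w)) isPreconnected_univ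
    (nomeHomeomorph.continuous.comp continuous_seg).continuousOn
    (continuous_nomeDisc.comp continuousOn_slitSection.domRestrict).continuousOn
    (fun w _ => ?_) (a := ⟨1 / 2, half_mem_slitPlane₂⟩) (mem_univ _) ?_ (mem_univ ⟨w, hw⟩)
  · rw [phiDisc_nomeDisc, lam_slitSection w.2]
    refine (phiDisc_nomeHomeomorph _).trans ?_
    change segMap (w : ℂ) 1 = w
    simp [segMap]
  · change nomeDiffeomorph (Surface.seg (1 / 2) half_mem_slitPlane₂.2) =
      nomeDisc (slitSection (1 / 2))
    rw [slitSection_half, ← toSurface_nomeDisc_I, nomeDiffeomorph_toSurface]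

theorem nomeDiffeomorph_seg_eq_exp {w : ℂ} (hw : w ∈ slitPlane₂) : ellipticK w ≠ 0 ∧
    (nomeDiffeomorph (Surface.seg w hw.2) : ℂ) =
      Complex.exp (-(Real.pi : ℂ) * (ellipticK (1 - w) / ellipticK w)) := by
  rw [nomeDiffeomorph_seg hw, ellipticK_eq_thetaSq hw, ellipticK_one_sub_eq_thetaSq hw,
    exp_quotient_eq_nome]
  exact ⟨mul_ne_zero (by simp) (thetaSq_ne_zero _), rfl⟩

/-! ### Continuation along curves -/

/-- The germ at time t is θ composed with the local inverse of λ near T t. For close times the two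
local inverses take the same value at γ s, hence coincide nearby. One statement serves K and K',
with different θ. -/
theorem isContinuation_comp_section {T : unitInterval → ℍ} (hT : ContinuousOn T {0}ᶜ)
    {γ : C(unitInterval, ℂ)} (hTγ : ∀ t, t ≠ 0 → lam (T t) = γ t) {t₀ : unitInterval}
    (ht₀ : t₀ ≠ 0) (hγ : γ t₀ ∈ slitPlane₂) (hst : T t₀ = slitSection (γ t₀))
    {e : ℍ → OpenPartialHomeomorph ℍ ℂ} (he : ∀ τ, τ ∈ (e τ).source) (hel : ∀ τ, lam = e τ)
    {f θ : ℂ → ℂ} (hθ : ∀ τ : ℍ, AnalyticAt ℂ θ τ)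
    (hf : ∀ w ∈ slitPlane₂, f w = θ (slitSection w)) :
    IsContinuation γ t₀ f fun t w => θ ((e (T t)).symm w) := by
  have hmem : ∀ t, t ≠ 0 → γ t ∈ (e (T t)).target := fun t ht => by
    rw [← hTγ t ht, hel (T t)]
    exact (e (T t)).map_source (he _)
  have hleft : ∀ τ, ∀ σ ∈ (e τ).source, (e τ).symm (lam σ) = σ := fun τ σ hσ => by
    rw [congrFun (hel τ) σ]
    exact (e τ).left_inv hσ
  have hright : ∀ τ, ∀ v ∈ (e τ).target, lam ((e τ).symm v) = v := fun τ v hv => by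
    rw [congrFun (hel τ) _]
    exact (e τ).right_inv hv
  have hne : ∀ t, t₀ ≤ t → t ≠ 0 := fun t ht h =>
    ht₀ (le_antisymm (h ▸ ht) unitInterval.nonneg')
  -- two sections that agree at a point agree nearby
  have hloc : ∀ τ (ρ : ℂ → ℍ) v, ContinuousAt ρ v → (∀ᶠ u in 𝓝 v, lam (ρ u) = u) →
      ρ v ∈ (e τ).source → ∀ᶠ u in 𝓝 v, (e τ).symm u = ρ u := by
    intro τ ρ v hρ hlρ hs
    filter_upwards [hlρ, hρ.eventually ((e τ).open_source.mem_nhds hs)] with u hu hus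
    conv_lhs => rw [← hu]
    exact hleft τ _ hus
  refine ⟨?_, fun t ht => ?_, fun t ht => ?_⟩
  · have h1 := hloc (T t₀) slitSection (γ t₀)
      (continuousOn_slitSection.continuousAt (isOpen_slitPlane₂.mem_nhds hγ))
      (by filter_upwards [isOpen_slitPlane₂.mem_nhds hγ] with u hu using lam_slitSection hu)
      (hst ▸ he _)
    filter_upwards [h1, isOpen_slitPlane₂.mem_nhds hγ] with u hu hu'
    rw [hu, hf u hu']
  · exact AnalyticAt.fun_comp (hθ _) (analyticOnNhd_section (e (T t)).open_target
      (e (T t)).continuousOn_symm (hright _) _ (hmem t (hne t ht)))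
  · have hTt := hT.continuousAt (isOpen_compl_singleton.mem_nhds (hne t ht))
    filter_upwards [self_mem_nhdsWithin, mem_nhdsWithin_of_mem_nhds
      (hTt.eventually ((e (T t)).open_source.mem_nhds (he _)))] with s hs hs'
    have hs0 := hne s hs
    have h1 := hloc (T t) (e (T s)).symm (γ s) ((e (T s)).continuousAt_symm (hmem s hs0))
      (by filter_upwards [(e (T s)).open_target.mem_nhds (hmem s hs0)] with u hu
          using hright _ u hu)
      (by rw [← hTγ s hs0, hleft _ _ (he _)]; exact hs')
    filter_upwards [h1] with u hu
    rw [hu]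

theorem isCurve_restrict (γ : Curve) (t₀ : unitInterval) (h : γ.1 t₀ ≠ 0) :
    IsCurve (γ.1.comp ⟨fun t => t * t₀, by fun_prop⟩) := by
  have ht₀ : t₀ ≠ 0 := fun h0 => h (h0 ▸ γ.2.1)
  refine ⟨by simp [γ.2.1], Or.inr fun t ht => ?_⟩
  refine (γ.2.2.resolve_left fun h' => h (h' t₀)) _ fun h' => ?_
  rcases mul_eq_zero.1 (congrArg Subtype.val h') with h1 | h1
  · exact ht (Subtype.ext h1)
  · exact ht₀ (Subtype.ext h1)

/-- Up to t₀ the curve stays in the unit disc, so its initial piece is homotopic to the segment and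
the formula of the first sheet applies. -/
theorem lift_eq_nomeDisc {γ : Curve} {Γ : C(unitInterval, disc)} (h0 : Γ 0 = 0)
    (hΓ : ∀ t, phiDisc (Γ t) = γ.1 t) {t₀ : unitInterval} (ht₀ : ∀ t, t ≤ t₀ → ‖γ.1 t‖ < 1)
    (hγ : γ.1 t₀ ∈ slitPlane₂) : Γ t₀ = nomeDisc (slitSection (γ.1 t₀)) := by
  have h1 := nomeDiffeomorph_lift (γ := ⟨_, isCurve_restrict γ t₀ (slitPlane₂_ne hγ).1⟩)
    (Γ := Γ.comp ⟨fun t => t * t₀, by fun_prop⟩) (by simp [h0]) fun t => hΓ _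
  have h2 : Surface.mk ⟨_, isCurve_restrict γ t₀ (slitPlane₂_ne hγ).1⟩ =
      Surface.seg (γ.1 t₀) hγ.2 := by
    refine Quotient.sound (homotopic_of_norm_lt (fun t => ht₀ _ ?_) ?_ ?_)
    · exact Subtype.coe_le_coe.1 (mul_le_of_le_one_left t₀.2.1 t.2.2)
    · exact norm_segMap_lt (ht₀ t₀ le_rfl)
    · simp [segMap]
  rw [h2, nomeDiffeomorph_seg hγ] at h1
  simpa using h1.symm

theorem exists_continuation (γ : Curve) (t₀ : unitInterval) (ht₀ : ∀ t, t ≤ t₀ → ‖γ.1 t‖ < 1)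
    (hγ₀ : γ.1 t₀ ∉ Complex.ofReal '' Set.Iic (0 : ℝ)) :
    ∃ F G : unitInterval → ℂ → ℂ,
      IsContinuation γ.1 t₀ ellipticK F ∧
      IsContinuation γ.1 t₀ (fun w => ellipticK (1 - w)) G ∧
      F 1 (γ.1 1) ≠ 0 ∧
      (nomeDiffeomorph (Surface.mk γ) : ℂ) =
        Complex.exp (-(Real.pi : ℂ) * (G 1 (γ.1 1) / F 1 (γ.1 1))) := by
  have hγ : γ.1 t₀ ∈ slitPlane₂ := ⟨hγ₀, notMem_of_norm_lt (ht₀ t₀ le_rfl)⟩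
  have hne := (slitPlane₂_ne hγ).1
  have h0 : t₀ ≠ 0 := fun h => hne (h ▸ γ.2.1)
  have hγ1 : γ.1 1 ≠ 0 :=
    ((γ.2.2.resolve_left fun h' => hne (h' t₀)) 1 (by simp)).1
  obtain ⟨Γ, hΓ0, hΓ⟩ := exists_lift γ
  obtain ⟨T, hTc, hT, hTt₀⟩ := exists_lift_upper hγ1 h0 (lam_slitSection hγ)
  -- Two lifts of γ on (0, 1] that agree at t₀; at t = 1 this identifies ψ([γ]) with the nome of T
  -- 1.
  have hΓT : EqOn Γ (fun t => nomeDisc (T t)) {0}ᶜ :=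
    phiDisc_eqOn isPreconnected_compl_zero Γ.continuous.continuousOn
      (continuous_nomeDisc.comp_continuousOn hTc)
      (fun t ht => by rw [hΓ, phiDisc_nomeDisc, hT t ht]) (a := t₀) h0
      (by rw [lift_eq_nomeDisc hΓ0 hΓ ht₀ hγ, hTt₀])
  choose e he hel using isLocalHomeomorph_lam
  have hθ : ∀ τ : ℍ, AnalyticAt ℂ (fun τ => Real.pi / 2 * thetaSq τ) τ := fun τ =>
    analyticAt_const.mul (analyticAt_thetaSq τ.2)
  have hθ' : ∀ τ : ℍ, AnalyticAt ℂ
      (fun τ => Real.pi / 2 * (-Complex.I * τ * thetaSq τ)) τ := fun τ =>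
    analyticAt_const.mul ((analyticAt_const.mul analyticAt_id).mul (analyticAt_thetaSq τ.2))
  have hend : (e (T 1)).symm (γ.1 1) = T 1 := by
    rw [← hT 1 (by simp), congrFun (hel (T 1)) _]
    exact (e (T 1)).left_inv (he _)
  refine ⟨_, _, isContinuation_comp_section hTc hT h0 hγ hTt₀ he hel hθ
    fun w hw => ellipticK_eq_thetaSq hw, isContinuation_comp_section hTc hT h0 hγ hTt₀ he hel hθ'
    fun w hw => ellipticK_one_sub_eq_thetaSq hw, ?_, ?_⟩
  · exact mul_ne_zero (by simp) (thetaSq_ne_zero _)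
  · simp only [hend]
    rw [exp_quotient_eq_nome, nomeDiffeomorph_lift hΓ0 hΓ, hΓT (x := 1) (by simp)]
    rfl

end

section

open Asymptotics

/-! ### The Maclaurin series of the inverse nome -/

theorem isBigO_sparseSeries_sub {e : ℤ → ℕ} (he : ∀ n, n.natAbs ≤ e n + 1) (s : Finset ℤ) {k : ℕ}
    (hs : ∀ n, n ∉ s → k ≤ e n) :
    (fun z => sparseSeries e z - ∑ n ∈ s, z ^ e n) =O[𝓝 0] fun z => z ^ k := by
  have hsum : Summable fun n : ℤ => (1 / 2 : ℝ) ^ e n :=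
    summable_norm_sparse he (by norm_num) (by norm_num)
  -- For |z| < 1/2 and e n = k + m, the term is at most |z|^k 2^{-m}, and 2^{-m} = 2^k 2^{-e n}.
  refine IsBigO.of_bound (∑' n : ↥((s : Set ℤ)ᶜ), 2 ^ k * (1 / 2 : ℝ) ^ e n) ?_
  filter_upwards [Metric.ball_mem_nhds (0 : ℂ) (show (0 : ℝ) < 1 / 2 by norm_num)] with z hz
  have hz2 : ‖z‖ < 1 / 2 := mem_ball_zero_iff.1 hz
  have h1 := (summable_norm_sparse_complex he (hz2.trans (by norm_num))).of_norm.sum_add_tsum_compl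
    (s := s)
  rw [sparseSeries, ← h1, add_sub_cancel_left, ← tsum_mul_right]
  refine tsum_of_norm_bounded (((hsum.mul_left (2 ^ k)).subtype _).mul_right _).hasSum fun n => ?_
  have hn := hs n n.2
  obtain ⟨m, hm⟩ := Nat.exists_eq_add_of_le hn
  simp only [Function.comp_apply, norm_mul, norm_pow, hm, pow_add]
  have h2 : (2 : ℝ) ^ k * (1 / 2) ^ k = 1 := by rw [← mul_pow]; norm_num
  calc ‖z‖ ^ k * ‖z‖ ^ m ≤ ‖z‖ ^ k * (1 / 2) ^ m := by gcongr
    _ = 2 ^ k * ((1 / 2) ^ k * (1 / 2) ^ m) * ‖z‖ ^ k := by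
      linear_combination -(‖z‖ ^ k * (1 / 2) ^ m) * h2

theorem isBigO_nomeB_sub : (fun z => nomeB z - (1 + 2 * z)) =O[𝓝 0] fun z => z ^ 3 := by
  have h := isBigO_sparseSeries_sub natAbs_le_sqExp {-1, 0, 1} (k := 3) fun n hn => by
    have := cast_sqExp n
    simp only [Finset.mem_insert, Finset.mem_singleton, not_or] at hn
    zify
    rw [this]
    rcases lt_or_gt_of_ne hn.2.1 with h | h
    · have : n ≤ -2 := by omega
      nlinarith
    · have : 2 ≤ n := by omega
      nlinarith
  refine h.congr_left fun z => ?_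
  simp [nomeB, sqExp]
  ring

theorem isBigO_nomeA_sub : (fun z => nomeA z - (2 + 2 * z ^ 2)) =O[𝓝 0] fun z => z ^ 3 := by
  have h := isBigO_sparseSeries_sub natAbs_le_prExp {-2, -1, 0, 1} (k := 3) fun n hn => by
    have := cast_prExp n
    simp only [Finset.mem_insert, Finset.mem_singleton, not_or] at hn
    zify
    rw [this]
    rcases lt_or_gt_of_ne hn.2.2.1 with h | h
    · have : n ≤ -3 := by omega
      nlinarith
    · have : 2 ≤ n := by omega
      nlinarith
  refine h.congr_left fun z => ?_
  simp [nomeA, prExp]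
  ring

theorem isBigO_pow_four_sub {f g h : ℂ → ℂ} (hf : ContinuousAt f 0) (hg : ContinuousAt g 0)
    (hfg : (fun z => f z - g z) =O[𝓝 0] h) : (fun z => f z ^ 4 - g z ^ 4) =O[𝓝 0] h := by
  have hc : ContinuousAt (fun z => f z ^ 3 + f z ^ 2 * g z + f z * g z ^ 2 + g z ^ 3) 0 := by
    fun_prop
  refine (hfg.mul (hc.isBigO_one ℂ)).congr (fun z => ?_) fun z => mul_one _
  ring

/-- The denominator is cleared, and z A⁴ is compared with the cubic times B⁴. An error z³ in A and B
suffices, since A⁴ carries the factor z and the cubic is O(z). -/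
theorem isBigO_phi_sub :
    (fun z => phi z - (16 * z - 128 * z ^ 2 + 704 * z ^ 3)) =O[𝓝 0] fun z => z ^ 4 := by
  have hA := isBigO_pow_four_sub (differentiableAt_nomeA (by simp)).continuousAt
    (by fun_prop) isBigO_nomeA_sub
  have hB := isBigO_pow_four_sub (differentiableAt_nomeB (by simp)).continuousAt
    (by fun_prop) isBigO_nomeB_sub
  have hBc : ContinuousAt (fun z => (nomeB z ^ 4)⁻¹) 0 :=
    ((differentiableAt_nomeB (by simp)).continuousAt.pow 4).inv₀
      (pow_ne_zero 4 (nomeB_ne_zero (by simp)))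
  have hid := isBigO_refl (fun z : ℂ => z) (𝓝 0)
  have h1 := hid.mul hA
  have h2 : (fun z : ℂ => 16 * z - 128 * z ^ 2 + 704 * z ^ 3) =O[𝓝 0] fun z => z := by
    have hc : ContinuousAt (fun z : ℂ => 16 - 128 * z + 704 * z ^ 2) 0 := by fun_prop
    refine (hid.mul (hc.isBigO_one ℂ)).congr (fun z => ?_) fun z => mul_one _
    ring
  have h3 := h2.mul hB
  -- The coefficients 16, -128 and 704 are those for which this polynomial is divisible by z⁴; the
  -- quotient is written out in `hc`.
  have h4 : (fun z : ℂ => z * (2 + 2 * z ^ 2) ^ 4 -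
      (16 * z - 128 * z ^ 2 + 704 * z ^ 3) * (1 + 2 * z) ^ 4) =O[𝓝 0] fun z => z ^ 4 := by
    have hc : ContinuousAt (fun z : ℂ => (-3072) * z ^ 0 + (-12960) * z ^ 1 + (-20480) * z ^ 2 + (-11200) * z ^ 3 + (16) * z ^ 5) 0 := by
      fun_prop
    refine ((isBigO_refl (fun z : ℂ => z ^ 4) (𝓝 0)).mul (hc.isBigO_one ℂ)).congr (fun z => ?_)
      fun z => mul_one _
    ring
  have h5 := (((h1.congr_right fun z => by ring).add h4).sub
    (h3.congr_right fun z => by ring)).mul (hBc.isBigO_one ℂ)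
  refine h5.congr' ?_ (Eventually.of_forall fun z => mul_one _)
  filter_upwards [Metric.ball_mem_nhds (0 : ℂ) one_pos] with z hz
  have := nomeB_ne_zero (mem_ball_zero_iff.1 hz)
  rw [phi]
  field_simp
  ring

/-- Strips off one coefficient: the limit at 0 gives c = 0, and then z is divided out, which is why
the neighbourhood is punctured. -/
theorem isBigO_pow_of_add_mul {c : ℂ} {g : ℂ → ℂ} (hg : ContinuousAt g 0) {k : ℕ}
    (h : (fun z => c + z * g z) =O[𝓝[≠] 0] fun z => z ^ (k + 1)) :
    c = 0 ∧ g =O[𝓝[≠] 0] fun z => z ^ k := by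
  have hc : c = 0 := by
    have h1 : Tendsto (fun z => c + z * g z) (𝓝[≠] 0) (𝓝 c) := by
      have : ContinuousAt (fun z => c + z * g z) 0 := by fun_prop
      have := this.tendsto
      simp only [zero_mul, add_zero] at this
      exact this.mono_left nhdsWithin_le_nhds
    have h2 : Tendsto (fun z : ℂ => z ^ (k + 1)) (𝓝[≠] 0) (𝓝 0) := by
      have : ContinuousAt (fun z : ℂ => z ^ (k + 1)) 0 := by fun_prop
      have := this.tendsto
      rw [zero_pow k.succ_ne_zero] at this
      exact this.mono_left nhdsWithin_le_nhds
    exact tendsto_nhds_unique h1 (h.trans_tendsto h2)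
  subst hc
  refine ⟨rfl, ?_⟩
  have h3 := h.mul (isBigO_refl (fun z : ℂ => z⁻¹) (𝓝[≠] 0))
  refine h3.congr' ?_ ?_ <;> filter_upwards [self_mem_nhdsWithin] with z hz <;>
    have hz : z ≠ 0 := hz
  · field_simp
    ring
  · field_simp
    ring

/-- The Maclaurin coefficients of the inverse nome. -/
def phiCoeff (n : ℕ) : ℂ := iteratedDeriv n phi 0 / n.factorial

theorem hasSum_phiCoeff {z : ℂ} (hz : ‖z‖ < 1) : HasSum (fun n => phiCoeff n * z ^ n) (phi z) := by
  have h := Complex.hasSum_taylorSeries_on_ball analyticOnNhd_phi.differentiableOn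
    (mem_ball_zero_iff.2 hz)
  refine h.congr_fun fun n => ?_
  simp [phiCoeff]
  ring

theorem phiCoeff_eq :
    phiCoeff 0 = 0 ∧ phiCoeff 1 = 16 ∧ phiCoeff 2 = -128 ∧ phiCoeff 3 = 704 := by
  have h1 := (analyticAt_phi (z := 0) (by simp)).hasFPowerSeriesAt.isBigO_sub_partialSum_pow 4
  have h2 : (fun z => phi z - (phiCoeff 0 + phiCoeff 1 * z + phiCoeff 2 * z ^ 2 +
      phiCoeff 3 * z ^ 3)) =O[𝓝 0] fun z => z ^ 4 := by
    refine (h1.congr_left fun z => ?_).trans (IsBigO.of_norm_right ?_)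
    · simp [FormalMultilinearSeries.partialSum, Finset.sum_range_succ, phiCoeff]
      ring
    · simpa only [norm_pow] using isBigO_refl _ _
  have h3 := (isBigO_phi_sub.sub h2).mono (nhdsWithin_le_nhds (s := {0}ᶜ))
  -- The difference of the two cubics is O(z⁴); written in Horner form it loses one coefficient at
  -- each application.
  obtain ⟨c0, h4⟩ := isBigO_pow_of_add_mul (c := phiCoeff 0) (k := 3)
    (g := fun z => (phiCoeff 1 - 16) + z * ((phiCoeff 2 + 128) + z * (phiCoeff 3 - 704)))
    (by fun_prop) (h3.congr_left fun z => by ring)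
  obtain ⟨c1, h5⟩ := isBigO_pow_of_add_mul (by fun_prop) h4
  obtain ⟨c2, h6⟩ := isBigO_pow_of_add_mul (by fun_prop) h5
  obtain ⟨c3, -⟩ := isBigO_pow_of_add_mul (c := phiCoeff 3 - 704) (g := fun _ => 0) (k := 0)
    (by fun_prop) (h6.congr_left fun z => by ring)
  exact ⟨c0, sub_eq_zero.1 c1, eq_neg_of_add_eq_zero_left c2, sub_eq_zero.1 c3⟩

end

end NomeSurface

end

theorem mainTheorem2 :
    ∃ ψ : Surface ≃ₘ^ω⟮𝓘(ℂ, ℂ), 𝓘(ℂ, ℂ)⟯ disc,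
      -- normalization at the origin
      (ψ Surface.origin : ℂ) = 0 ∧
      -- the nome formula with principal branches on the doubly slit first sheet
      (∀ (w : ℂ) (_ : w ∉ Complex.ofReal '' Set.Iic (0 : ℝ))
        (h₁ : w ∉ Complex.ofReal '' Set.Ici (1 : ℝ)),
        ellipticK w ≠ 0 ∧
        (ψ (Surface.seg w h₁) : ℂ) =
          Complex.exp (-(Real.pi : ℂ) * (ellipticK (1 - w) / ellipticK w))) ∧
      -- the nome formula on all sheets, by analytic continuation along curves
      (∀ (γ : Curve) (t₀ : unitInterval), (∀ t, t ≤ t₀ → ‖γ.1 t‖ < 1) →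
        γ.1 t₀ ∉ Complex.ofReal '' Set.Iic (0 : ℝ) →
        ∃ F G : unitInterval → ℂ → ℂ,
          IsContinuation γ.1 t₀ ellipticK F ∧
          IsContinuation γ.1 t₀ (fun w => ellipticK (1 - w)) G ∧
          F 1 (γ.1 1) ≠ 0 ∧
          (ψ (Surface.mk γ) : ℂ) =
            Complex.exp (-(Real.pi : ℂ) * (G 1 (γ.1 1) / F 1 (γ.1 1)))) ∧
      -- the Maclaurin series of the inverse, convergent in the whole disc
      (∃ a : ℕ → ℂ, a 0 = 0 ∧ a 1 = 16 ∧ a 2 = -128 ∧ a 3 = 704 ∧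
        ∀ z : disc, HasSum (fun n : ℕ => a n * (z : ℂ) ^ n) (Surface.proj (ψ.symm z))) := by
  refine ⟨nomeDiffeomorph, congrArg Subtype.val nomeDiffeomorph_origin,
    fun w h₀ h₁ => nomeDiffeomorph_seg_eq_exp (w := w) ⟨h₀, h₁⟩, exists_continuation,
    phiCoeff, phiCoeff_eq.1, phiCoeff_eq.2.1, phiCoeff_eq.2.2.1, phiCoeff_eq.2.2.2, fun z => ?_⟩
  rw [proj_nomeDiffeomorph_symm]
  exact hasSum_phiCoeff (disc.norm_lt z)
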